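/- Let $G$ be a finitely generated residually finite group. Then there exist a finitely generated branch group $\Gamma$ and a Frattini embedding $\iota\colon G\to\Gamma$, i.e. an injective homomorphism such that any two elements $g,h\in G$ are conjugate in $G$ if and only if $\iota(g),\iota(h)$ are conjugate in $\Gamma$. Moreover, if $G$ is recursively presented and $\mathrm{EFRF}^{+}$, then there exist a finitely generated branch group $\Gamma$ that is recursively presented and $\mathrm{EFRF}^{+}$, and a Frattini embedding $\iota\colon G\to\Gamma$. Here the following terminology is used. Branch groups. Let $X=(X_n)_{n\ge 1}$ be a sequence of finite sets with $|X_n|\ge 2$. The rooted tree $\mathcal T_X$ has as vertices the words in $X^\ell=X_1\times\dots\times X_\ell$, $\ell\ge 0$, with the empty word as root, two words being adjacent iff one is obtained from the other by appending one letter; $\mathrm{Aut}(\mathcal T_X)$ is the group of graph automorphisms fixing the root. For $K\le \mathrm{Aut}(\mathcal T_X)$ and a vertex $v$, the rigid stabilizer $\mathrm{RiSt}_K(v)$ consists of the elements of $K$ that fix $v$ and every vertex that does not start with $v$, and $\mathrm{RiSt}_K(\ell)$ is the subgroup generated by all $\mathrm{RiSt}_K(v)$ with $v\in X^\ell$. The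 group $K$ is a branch subgroup if it acts transitively on $X^\ell$ and $\mathrm{RiSt}_K(\ell)$ has finite index in $K$ for every $\ell\ge 0$. A branch group is a group isomorphic to a branch subgroup of $\mathrm{Aut}(\mathcal T_X)$ for some such $X$. Algorithmic notions. A group is recursively presented if it has a presentation with finitely many generators and a recursively enumerable set of relators. A group $G$ is $\mathrm{EFRF}^{+}$ (effectively residually finite with co-semi-decidable word problem) if it has a finite generating set $S$ and there is an algorithm that takes as input a word $w$ in the letters of $S$ and their inverses and behaves as follows, where $\overline w\in G$ is the element represented by $w$: if $\overline w\ne 1$, it halts and outputs a homomorphism $f_w$ from $G$ onto a finite permutation group, described by the degree of the group and the permutations $f_w(s)$, $s\in S$, such that $f_w(\overline w)\neq 1$; if $\overline w=1$, it does not halt. -/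

import Mathlib

/-! Rooted trees and their automorphisms -/

/-- Vertices of the spherically homogeneous rooted tree with alphabets `X 0, X 1, …`:
finite words whose `i`-th letter lies in `X i`.  The level of a vertex `v` is `v.1`. -/
abbrev TreeVertex (X : ℕ → Type) : Type :=
  Σ l : ℕ, (i : Fin l) → X i

/-- The root, i.e. the empty word. -/
def treeRoot (X : ℕ → Type) : TreeVertex X :=
  ⟨0, fun i => i.elim0⟩

/-- The word `v x`, obtained by appending the letter `x` to the word `v`. -/
def TreeVertex.append {X : ℕ → Type} (v : TreeVertex X) (x : X v.1) : TreeVertex X :=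
  ⟨v.1 + 1, Fin.snoc (α := fun i : Fin (v.1 + 1) => X i) v.2 x⟩

/-- The word `w` starts with the word `v`, i.e. `w` is a vertex of the subtree below `v`. -/
def TreeVertex.IsPrefix {X : ℕ → Type} (v w : TreeVertex X) : Prop :=
  ∃ h : v.1 ≤ w.1, ∀ i : Fin v.1, w.2 (Fin.castLE h i) = v.2 i

/-- The spherically homogeneous rooted tree associated to `X`: two words are joined by an edge
iff one of them is obtained from the other one by appending a letter. -/
def rootedTree (X : ℕ → Type) : SimpleGraph (TreeVertex X) where
  Adj v w := (∃ x : X v.1, w = v.append x) ∨ (∃ x : X w.1, v = w.append x)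
  symm := ⟨fun _ _ h => h.symm⟩
  loopless := ⟨fun v h => by
    rcases h with ⟨x, hx⟩ | ⟨x, hx⟩ <;>
    · have h1 := congrArg Sigma.fst hx
      simp [TreeVertex.append] at h1⟩

/-- The group of all graph automorphisms of the tree that fix the root. -/
def rootedTreeAut (X : ℕ → Type) : Subgroup (rootedTree X ≃g rootedTree X) where
  carrier := {g | g (treeRoot X) = treeRoot X}
  one_mem' := rfl
  mul_mem' := fun {a b} ha hb => by
    change a (b (treeRoot X)) = treeRoot X
    rw [show b (treeRoot X) = treeRoot X from hb]
    exact ha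
  inv_mem' := fun {a} ha => by
    change a.symm (treeRoot X) = treeRoot X
    rw [RelIso.symm_apply_eq]
    exact (show a (treeRoot X) = treeRoot X from ha).symm

/-- The automorphism group `Aut(T_X)` of the rooted tree. -/
abbrev TreeAut (X : ℕ → Type) : Type := rootedTreeAut X

/-! Branch groups -/

/-- `K` acts transitively on every level of the tree. -/
def IsSphericallyTransitive {X : ℕ → Type} (K : Subgroup (TreeAut X)) : Prop :=
  ∀ (l : ℕ) (v w : (i : Fin l) → X i),
    ∃ g ∈ K, g.1 (⟨l, v⟩ : TreeVertex X) = (⟨l, w⟩ : TreeVertex X)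

/-- The rigid stabilizer of the vertex `v` in `K`: the elements of `K` that fix `v` and fix
all vertices outside the subtree of words that start with `v`. -/
def rigidStabilizer {X : ℕ → Type} (K : Subgroup (TreeAut X)) (v : TreeVertex X) :
    Subgroup (TreeAut X) where
  carrier := {g | g ∈ K ∧ g.1 v = v ∧ ∀ w : TreeVertex X, ¬ v.IsPrefix w → g.1 w = w}
  one_mem' := ⟨K.one_mem, rfl, fun _ _ => rfl⟩
  mul_mem' := fun {a b} ha hb => by
    refine ⟨K.mul_mem ha.1 hb.1, ?_, fun w hw => ?_⟩
    · change a.1 (b.1 v) = v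
      rw [hb.2.1, ha.2.1]
    · change a.1 (b.1 w) = w
      rw [hb.2.2 w hw, ha.2.2 w hw]
  inv_mem' := fun {a} ha => by
    refine ⟨K.inv_mem ha.1, ?_, fun w hw => ?_⟩
    · change a.1.symm v = v
      rw [RelIso.symm_apply_eq]
      exact ha.2.1.symm
    · change a.1.symm w = w
      rw [RelIso.symm_apply_eq]
      exact (ha.2.2 w hw).symm

/-- The rigid level `l` stabilizer of `K`: the subgroup generated by the rigid stabilizers of
the vertices of level `l`. -/
def rigidLevelStabilizer {X : ℕ → Type} (K : Subgroup (TreeAut X)) (l : ℕ) :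
    Subgroup (TreeAut X) :=
  ⨆ v : (i : Fin l) → X i, rigidStabilizer K ⟨l, v⟩

/-- `K` is a branch subgroup of `Aut(T_X)`: it acts spherically transitively and all its rigid
level stabilizers have finite index in `K`. -/
def IsBranchSubgroup {X : ℕ → Type} (K : Subgroup (TreeAut X)) : Prop :=
  IsSphericallyTransitive K ∧ ∀ l : ℕ, ((rigidLevelStabilizer K l).subgroupOf K).FiniteIndex

/-- A branch group: a group that is isomorphic to a branch subgroup of the automorphism group of
a spherically homogeneous rooted tree, whose alphabets are finite with at least two letters. -/
def IsBranchGroup (Γ : Type*) [Group Γ] : Prop :=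
  ∃ X : ℕ → Type, (∀ n, Finite (X n)) ∧ (∀ n, Nontrivial (X n)) ∧
    ∃ K : Subgroup (TreeAut X), IsBranchSubgroup K ∧ Nonempty (Γ ≃* K)

/-! Frattini embeddings -/

/-- A Frattini embedding: an injective homomorphism such that two elements are conjugate in the
source iff their images are conjugate in the target. -/
def IsFrattiniEmbedding {G Γ : Type*} [Group G] [Group Γ] (f : G →* Γ) : Prop :=
  Function.Injective f ∧ ∀ g h : G, IsConj g h ↔ IsConj (f g) (f h)

/-! Algorithmic notions -/

/-- Words over a symmetric alphabet with `n` letters `s_i` (coded by `(i, true)`) and their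
formal inverses (coded by `(i, false)`). -/
abbrev SymWord (n : ℕ) : Type := List (Fin n × Bool)

/-- The element of `G` that is represented by a word over the generators `s i` and their
inverses. -/
def wordEval {G : Type*} [Group G] {n : ℕ} (s : Fin n → G) (w : SymWord n) : G :=
  (w.map fun p => cond p.2 (s p.1) (s p.1)⁻¹).prod

/-- `G` has a presentation with finitely many generators and a recursively enumerable set of
relators. -/
def IsRecursivelyPresented (G : Type*) [Group G] : Prop :=
  ∃ (n : ℕ) (R : SymWord n → Prop), REPred R ∧
    Nonempty (PresentedGroup {r : FreeGroup (Fin n) | ∃ w, R w ∧ FreeGroup.mk w = r} ≃* G)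

/-- The finite description of a homomorphism `f` from `G` onto a finite group of permutations of
`{0, …, m - 1}`: the degree `m`, together with the list of the values of `f` on the generators
`s i`, each value being written as the list of the images of `0, …, m - 1`. -/
def homCode {G : Type*} [Group G] {n m : ℕ} (s : Fin n → G) (f : G →* Equiv.Perm (Fin m)) :
    ℕ × List (List ℕ) :=
  (m, List.ofFn fun i : Fin n => List.ofFn fun k : Fin m => (f (s i) k : ℕ))

/-- `G` is effectively residually finite with co-semi-decidable word problem: for a finite
generating family `s` there is a partial computable function `M` on words that does not halt on
words representing `1`, and on every other word `w` halts with the description of a homomorphism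
to a finite group that does not kill the element represented by `w`. -/
def IsEFRFPlus (G : Type*) [Group G] : Prop :=
  ∃ (n : ℕ) (s : Fin n → G), Subgroup.closure (Set.range s) = ⊤ ∧
    ∃ M : SymWord n →. ℕ × List (List ℕ), Partrec M ∧ ∀ w : SymWord n,
      (wordEval s w ≠ 1 →
        ∃ (m : ℕ) (f : G →* Equiv.Perm (Fin m)),
          f (wordEval s w) ≠ 1 ∧ homCode s f ∈ M w) ∧
      (wordEval s w = 1 → ¬ (M w).Dom)

/-!
The branch group is a group of permutations of the set `List ℕ` of all words over `ℕ` that preserves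
the words whose `n`-th letter is less than `m n`, i.e. the vertices of a rooted tree.  Let `H` be a
group with, for every level `n`, some actions `act n j`, `1 ≤ j ≤ 4`, on the alphabet
`{0, …, m n - 1}` by even permutations, such that these actions together generate the alternating
group (`ActionData`).  The group `Γ n` (`ActionData.grp`) is generated by the rooted permutations
`letter n j h`, `j ≠ 0`, which apply `act n j h` to the first letter, and by the directed
permutations `letter n 0 h`, whose section at the letter `a` is `letter (n + 1) a h`; thus a directed
permutation is rooted below each of the words `0…0a` with `1 ≤ a ≤ 4`.

*Branching.*  Conjugating directed permutations by even permutations of the alphabet moves their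
nontrivial sections to other letters, so that any two generators of `Γ (n + 1)` are sections at `0`
of elements of `Γ n` whose supports on the first level meet in the letter `0` only.  Commutators of
such elements act below `0` alone.  Thus the subgroup of those `x` in `Γ (n + 1)` whose copy below
`0` belongs to `Γ n` is normal and contains all commutators
(`ActionData.commutator_mem_comap_atLetter`); it contains the rooted even permutations, since
3-cycles are commutators, and then also the directed permutations, as all their sections other than
the one at `0` are rooted.  So it is all of `Γ (n + 1)` (`ActionData.atLetter_mem`).  Hence `Γ n` is
the permutational wreath product of `Γ (n + 1)` with the alternating group, level stabilizers are
products of rigid stabilizers, and `Γ 0` is a branch group (`ActionData.isBranchGroup`).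

*Conjugacy.*  A product of two directed permutations is directed, a product of two rooted ones is
rooted, and a mixed product becomes rooted or directed after passing to sections once.  Therefore
all sections of a given `x ∈ Γ 0` at sufficiently long words are rooted or directed
(`ActionData.exists_isContracted`).  If `x` conjugates a nontrivial directed permutation to a
directed permutation, then it must preserve the word `000…`, and its section along this word is
eventually directed, which gives a conjugating element of `H` (`ActionData.isConj_of_isContracted`).
So `H` embeds into `Γ 0` as the directed permutations without fusion of conjugacy classes.

*The construction.*  For a finitely generated residually finite group `G`, take `H = G × (ℤ/3)³`
(`rotData`): `G` acts at level `n` by its `n`-th finite quotient, doubled in order to be even, and the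
three cyclic factors rotate blocks of length three, which generates the alternating group
(`evenPerms_le_of_blockRot`).  Every nontrivial element of `G` survives in infinitely many of the
finite quotients, which makes the directed permutations faithful.

*Algorithms.*  The contraction is effective.  A word in the generators represents `1` iff, for some
`l`, it fixes all words of length `l + 1` and its sections at words of length `l` are products of
rooted letters only, or products of directed letters only whose underlying element of `H` is trivial
(`ActionData.Describes.codesVal_eq_one_iff`).  This is recursively enumerable if the word problem of
`H` is (`ActionData.Describes.rePred`), and a group with recursively enumerable word problem is recursively
presented (`isRecursivelyPresented_of_rePred`).  A nontrivial element moves a word of some length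
`l`, and the action on the words of length `l` is the finite quotient needed for `IsEFRFPlus`
(`ActionData.Describes.isEFRFPlus`).  Both arguments need the finite quotients of `G` to be
computable uniformly in `n`, which `IsEFRFPlus.exists_actions` achieves by running the given
algorithm for longer and longer times on all inputs.
-/

open Equiv

/-! ### Wreath recursion -/

/-- The permutation of words over `ℕ` that applies `σ` to the first letter and then, depending on
this first letter `a`, the permutation `s a` to the rest of the word. -/
def wreath (σ : Perm ℕ) (s : ℕ → Perm (List ℕ)) : Perm (List ℕ) where
  toFun w := match w with
    | [] => []
    | a :: w => σ a :: s a w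
  invFun w := match w with
    | [] => []
    | a :: w => σ⁻¹ a :: (s (σ⁻¹ a))⁻¹ w
  left_inv w := by cases w <;> simp
  right_inv w := by cases w <;> simp

@[simp] lemma wreath_nil (σ : Perm ℕ) (s : ℕ → Perm (List ℕ)) : wreath σ s [] = [] := rfl

@[simp] lemma wreath_cons (σ : Perm ℕ) (s : ℕ → Perm (List ℕ)) (a : ℕ) (w : List ℕ) :
    wreath σ s (a :: w) = σ a :: s a w := rfl

lemma wreath_mul (σ τ : Perm ℕ) (s t : ℕ → Perm (List ℕ)) :
    wreath σ s * wreath τ t = wreath (σ * τ) (fun a => s (τ a) * t a) := by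
  ext1 w; cases w <;> simp

@[simp] lemma wreath_one : wreath 1 (fun _ => 1) = 1 := by
  ext1 w; cases w <;> simp

lemma wreath_inv (σ : Perm ℕ) (s : ℕ → Perm (List ℕ)) :
    (wreath σ s)⁻¹ = wreath σ⁻¹ (fun a => (s (σ⁻¹ a))⁻¹) := by
  rw [inv_eq_iff_mul_eq_one, wreath_mul]
  simp

lemma wreath_injective {σ τ : Perm ℕ} {s t : ℕ → Perm (List ℕ)} (h : wreath σ s = wreath τ t) :
    σ = τ ∧ s = t := by
  have h' : ∀ a w, σ a :: s a w = τ a :: t a w := fun a w => by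
    rw [← wreath_cons, h, wreath_cons]
  constructor
  · ext a; exact (List.cons.inj (h' a [])).1
  · funext a; ext1 w; exact (List.cons.inj (h' a w)).2

/-- The permutation of words that only changes the first letter. -/
def rooted : Perm ℕ →* Perm (List ℕ) where
  toFun σ := wreath σ (fun _ => 1)
  map_one' := wreath_one
  map_mul' σ τ := by rw [wreath_mul]; simp

lemma rooted_def (σ : Perm ℕ) : rooted σ = wreath σ (fun _ => 1) := rfl

@[simp] lemma rooted_cons (σ : Perm ℕ) (a : ℕ) (w : List ℕ) : rooted σ (a :: w) = σ a :: w := rfl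

/-- The permutation of words that fixes the first letter `a` and applies `s a` to the rest. -/
def levelOne : (ℕ → Perm (List ℕ)) →* Perm (List ℕ) where
  toFun s := wreath 1 s
  map_one' := wreath_one
  map_mul' s t := by rw [wreath_mul]; simp; rfl

lemma levelOne_def (s : ℕ → Perm (List ℕ)) : levelOne s = wreath 1 s := rfl

@[simp] lemma levelOne_cons (s : ℕ → Perm (List ℕ)) (a : ℕ) (w : List ℕ) :
    levelOne s (a :: w) = a :: s a w := rfl

lemma rooted_conj_levelOne (σ : Perm ℕ) (s : ℕ → Perm (List ℕ)) :
    rooted σ * levelOne s * (rooted σ)⁻¹ = levelOne (fun a => s (σ⁻¹ a)) := by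
  rw [rooted_def, levelOne_def, wreath_inv, wreath_mul, wreath_mul, levelOne_def]; simp

/-- The permutation of words that applies a given permutation to the words below the letter `a`
and fixes all words that do not start with `a`. -/
def atLetter (a : ℕ) : Perm (List ℕ) →* Perm (List ℕ) :=
  levelOne.comp (MonoidHom.mulSingle (fun _ : ℕ => Perm (List ℕ)) a)

lemma atLetter_apply (a : ℕ) (g : Perm (List ℕ)) :
    atLetter a g = levelOne (Pi.mulSingle a g) := rfl

lemma rooted_conj_atLetter (σ : Perm ℕ) (a : ℕ) (g : Perm (List ℕ)) :
    rooted σ * atLetter a g * (rooted σ)⁻¹ = atLetter (σ a) g := by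
  rw [atLetter_apply, rooted_conj_levelOne, atLetter_apply]
  congr 1
  funext b
  by_cases h : b = σ a
  · subst h; simp
  · have h' : σ⁻¹ b ≠ a := fun h'' => h (by rw [← h'']; simp)
    rw [Pi.mulSingle_eq_of_ne h, Pi.mulSingle_eq_of_ne h']

/-- A tuple of sections with finite support is a product of sections at single letters. -/
lemma levelOne_mem {K : Subgroup (Perm (List ℕ))} {s : ℕ → Perm (List ℕ)} (M : ℕ)
    (hs : ∀ a, M ≤ a → s a = 1) (hK : ∀ a < M, atLetter a (s a) ∈ K) : levelOne s ∈ K := by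
  induction M generalizing s with
  | zero =>
    have : s = 1 := funext fun a => hs a (Nat.zero_le a)
    rw [this, map_one]; exact K.one_mem
  | succ M ih =>
    have h1 : levelOne (Function.update s M 1) ∈ K := by
      apply ih
      · intro a ha
        by_cases h : a = M
        · subst h; simp
        · rw [Function.update_of_ne h]; exact hs a (by omega)
      · intro a ha
        rw [Function.update_of_ne (by omega)]; exact hK a (by omega)
    have h2 : levelOne s = levelOne (Function.update s M 1) * atLetter M (s M) := by
      rw [atLetter_apply, ← map_mul]
      congr 1
      funext a
      by_cases h : a = M
      · subst h; simp
      · simp [h]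
    rw [h2]
    exact K.mul_mem h1 (hK M (by omega))

/-! ### The groups of even permutations -/

/-- The even permutations of `ℕ` that are supported on `{0, …, m - 1}`, as the group generated by
the products of two transpositions. -/
def evenPerms (m : ℕ) : Subgroup (Perm ℕ) :=
  Subgroup.closure {σ | ∃ a b c d, a < m ∧ b < m ∧ c < m ∧ d < m ∧ a ≠ b ∧ c ≠ d ∧
    σ = swap a b * swap c d}

lemma swap_mul_swap_mem_evenPerms {m a b c d : ℕ} (ha : a < m) (hb : b < m) (hc : c < m)
    (hd : d < m) (hab : a ≠ b) (hcd : c ≠ d) : swap a b * swap c d ∈ evenPerms m :=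
  Subgroup.subset_closure ⟨a, b, c, d, ha, hb, hc, hd, hab, hcd, rfl⟩

lemma evenPerms_apply_of_le {m : ℕ} {σ : Perm ℕ} (hσ : σ ∈ evenPerms m) {x : ℕ} (hx : m ≤ x) :
    σ x = x := by
  induction hσ using Subgroup.closure_induction with
  | mem σ h =>
    obtain ⟨a, b, c, d, ha, hb, hc, hd, -, -, rfl⟩ := h
    rw [Perm.mul_apply, swap_apply_of_ne_of_ne (a := c), swap_apply_of_ne_of_ne] <;> omega
  | one => rfl
  | mul σ τ _ _ h1 h2 => rw [Perm.mul_apply, h2, h1]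
  | inv σ _ h => rw [Perm.inv_eq_iff_eq, h]

lemma evenPerms_apply_lt {m : ℕ} {σ : Perm ℕ} (hσ : σ ∈ evenPerms m) {x : ℕ} :
    σ x < m ↔ x < m := by
  constructor
  · intro h
    by_contra hx
    rw [evenPerms_apply_of_le hσ (by omega)] at h
    exact hx h
  · intro h
    by_contra hx
    have := evenPerms_apply_of_le (inv_mem hσ) (x := σ x) (by omega)
    rw [← Perm.mul_apply, inv_mul_cancel, Perm.one_apply] at this
    omega

/-- The 3-cycle `a ↦ b ↦ c ↦ a`. -/
def threeCycle (a b c : ℕ) : Perm ℕ := swap a b * swap b c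

lemma threeCycle_mem {m a b c : ℕ} (ha : a < m) (hb : b < m) (hc : c < m) (hab : a ≠ b)
    (hbc : b ≠ c) : threeCycle a b c ∈ evenPerms m :=
  swap_mul_swap_mem_evenPerms ha hb hb hc hab hbc

lemma conj_threeCycle (σ : Perm ℕ) (a b c : ℕ) :
    σ * threeCycle a b c * σ⁻¹ = threeCycle (σ a) (σ b) (σ c) := by
  have h : ∀ x y, swap (σ x) (σ y) = σ * swap x y * σ⁻¹ := fun x y => by
    ext z; simp [swap_apply_apply]
  rw [threeCycle, threeCycle, h, h]; group

lemma threeCycle_inv (a b c : ℕ) : (threeCycle a b c)⁻¹ = threeCycle c b a := by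
  rw [threeCycle, threeCycle, mul_inv_rev, swap_inv, swap_inv, swap_comm b c, swap_comm a b]

lemma threeCycle_rotate (a b c : ℕ) (hab : a ≠ b) (hac : a ≠ c) :
    threeCycle b c a = threeCycle a b c := by
  rw [threeCycle, mul_swap_eq_swap_mul, swap_apply_right, swap_apply_of_ne_of_ne hab hac,
    swap_comm b a, threeCycle]

lemma evenPerms_le_of_threeCycle {m : ℕ} {K : Subgroup (Perm ℕ)}
    (h : ∀ a b c, a < m → b < m → c < m → a ≠ b → b ≠ c → a ≠ c → threeCycle a b c ∈ K) :
    evenPerms m ≤ K := by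
  have h' : ∀ a b c, a < m → b < m → c < m → a ≠ b → b ≠ c → swap a b * swap b c ∈ K := by
    intro a b c ha hb hc hab hbc
    by_cases hac : a = c
    · subst hac; rw [swap_comm b a, swap_mul_self]; exact K.one_mem
    · exact h a b c ha hb hc hab hbc hac
  rw [evenPerms, Subgroup.closure_le]
  rintro _ ⟨a, b, c, d, ha, hb, hc, hd, hab, hcd, rfl⟩
  by_cases hbc : b = c
  · subst hbc; exact h' a b d ha hb hd hab hcd
  · have : swap a b * swap c d = (swap a b * swap b c) * (swap b c * swap c d) := by
      rw [mul_assoc, ← mul_assoc (swap b c), swap_mul_self, one_mul]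
    rw [this]
    exact K.mul_mem (h' a b c ha hb hc hab hbc) (h' b c d hb hc hd hbc hcd)

/-- The 3-cycles `0 ↦ 1 ↦ j ↦ 0` generate all even permutations. -/
lemma evenPerms_le_of_threeCycle_zero_one {m : ℕ} {K : Subgroup (Perm ℕ)}
    (h : ∀ j, 2 ≤ j → j < m → threeCycle 0 1 j ∈ K) : evenPerms m ≤ K := by
  have e1 : ∀ i j : ℕ, swap 0 i * swap 0 j = (swap 0 1 * swap 0 i)⁻¹ * (swap 0 1 * swap 0 j) := by
    intro i j
    rw [mul_inv_rev, swap_inv, swap_inv, mul_assoc, ← mul_assoc (swap 0 1), swap_mul_self, one_mul]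
  have e2 : ∀ j, 0 < j → j < m → swap 0 1 * swap 0 j ∈ K := by
    intro j hj hjm
    by_cases h1 : j = 1
    · subst h1; rw [swap_mul_self]; exact K.one_mem
    · have hh := h j (by omega) hjm
      have : swap 0 1 * swap 0 j = (threeCycle 0 1 j)⁻¹ := by
        rw [← threeCycle_rotate 0 1 j (by omega) (by omega), ← threeCycle_rotate 1 j 0 (by omega)
          (by omega), threeCycle_inv, threeCycle, swap_comm 1 0]
      rw [this]
      exact K.inv_mem hh
  have e3 : ∀ i j, 0 < i → i < m → 0 < j → j < m → swap 0 i * swap 0 j ∈ K := by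
    intro i j hi him hj hjm
    rw [e1]; exact K.mul_mem (K.inv_mem (e2 i hi him)) (e2 j hj hjm)
  -- every transposition is an odd word in the transpositions `(0 i)`
  have e5 : ∀ i j, 0 < i → 0 < j → i ≠ j → swap i j = swap 0 i * swap 0 j * swap 0 i := by
    intro i j hi hj hij
    have := swap_apply_apply (swap 0 i) 0 j
    rw [swap_apply_left, swap_apply_of_ne_of_ne (by omega) (by omega)] at this
    rw [this]; rfl
  have e6 : ∀ i j, i < m → j < m → i ≠ j →
      ∃ k ∈ K, ∃ l, 0 < l ∧ l < m ∧ swap i j = k * swap 0 l := by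
    intro i j hi hj hij
    rcases Nat.eq_zero_or_pos i with rfl | hi0
    · exact ⟨1, K.one_mem, j, by omega, hj, by simp⟩
    rcases Nat.eq_zero_or_pos j with rfl | hj0
    · exact ⟨1, K.one_mem, i, by omega, hi, by simp [swap_comm]⟩
    exact ⟨_, e3 i j hi0 hi hj0 hj, i, hi0, hi, e5 i j hi0 hj0 hij⟩
  have e7 : ∀ i j, i < m → j < m → i ≠ j →
      ∃ k ∈ K, ∃ l, 0 < l ∧ l < m ∧ swap i j = swap 0 l * k := by
    intro i j hi hj hij
    obtain ⟨k, hk, l, hl, hlm, e⟩ := e6 i j hi hj hij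
    refine ⟨k⁻¹, K.inv_mem hk, l, hl, hlm, ?_⟩
    rw [← swap_inv i j, e, mul_inv_rev, swap_inv]
  rw [evenPerms, Subgroup.closure_le]
  rintro _ ⟨a, b, c, d, ha, hb, hc, hd, hab, hcd, rfl⟩
  obtain ⟨k, hk, l, hl, hlm, h1⟩ := e6 a b ha hb hab
  obtain ⟨k', hk', l', hl', hlm', h2⟩ := e7 c d hc hd hcd
  rw [h1, h2, mul_assoc, ← mul_assoc (swap 0 l)]
  exact K.mul_mem hk (K.mul_mem (e3 l l' hl hlm hl' hlm') hk')

/-- A 3-cycle is the commutator of two 3-cycles that share a single point. -/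
lemma threeCycle_eq_commutator {a b c d e : ℕ} (hl : [a, b, c, d, e].Nodup) :
    threeCycle a b d * threeCycle a c e * (threeCycle a b d)⁻¹ * (threeCycle a c e)⁻¹ =
      threeCycle a b c := by
  simp only [List.nodup_cons, List.mem_cons, List.not_mem_nil, not_or] at hl
  obtain ⟨⟨hab, hac, had, hae, -⟩, ⟨hbc, hbd, hbe, -⟩, ⟨hcd, hce, -⟩, ⟨hde, -⟩, -⟩ := hl
  have h1 : threeCycle a b d a = b := by
    rw [threeCycle, Perm.mul_apply, swap_apply_of_ne_of_ne hab had, swap_apply_left]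
  have h2 : threeCycle a b d c = c := by
    rw [threeCycle, Perm.mul_apply, swap_apply_of_ne_of_ne (Ne.symm hbc) hcd,
      swap_apply_of_ne_of_ne (Ne.symm hac) (Ne.symm hbc)]
  have h3 : threeCycle a b d e = e := by
    rw [threeCycle, Perm.mul_apply, swap_apply_of_ne_of_ne (Ne.symm hbe) (Ne.symm hde),
      swap_apply_of_ne_of_ne (Ne.symm hae) (Ne.symm hbe)]
  rw [conj_threeCycle, h1, h2, h3, threeCycle_inv, ← threeCycle_rotate a b c hab hac]
  simp only [threeCycle]
  rw [swap_comm e c, mul_assoc, ← mul_assoc (swap c e), swap_mul_self, one_mul]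

lemma evenPerms_exists_map {m a b : ℕ} (hm : 3 ≤ m) (ha : a < m) (hb : b < m) :
    ∃ σ ∈ evenPerms m, σ a = b := by
  by_cases h : a = b
  · exact ⟨1, one_mem _, h⟩
  · obtain ⟨c, hc, hca, hcb⟩ : ∃ c < m, c ≠ a ∧ c ≠ b := by
      by_contra hcon
      push Not at hcon
      have h0 := hcon 0 (by omega)
      have h1 := hcon 1 (by omega)
      have h2 := hcon 2 (by omega)
      omega
    refine ⟨threeCycle a b c, threeCycle_mem ha hb hc h hcb.symm, ?_⟩
    rw [threeCycle, Perm.mul_apply, swap_apply_of_ne_of_ne h hca.symm, swap_apply_left]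

/-! ### The groups generated by rooted and directed permutations -/

/-- A family of finite permutation actions of a group `H`, from which a branch group is built.
The alphabet at level `n` of the tree is `{0, …, m n - 1}`, and `act n j` for `1 ≤ j ≤ 4` are
actions of `H` on this alphabet by even permutations that together generate all of them.  The
value `j = 0` is reserved for the directed permutations. -/
structure ActionData (H : Type*) [Group H] where
  /-- the size of the alphabet at level `n` -/
  m : ℕ → ℕ
  /-- the `j`-th action on the alphabet at level `n` -/
  act : ℕ → ℕ → H →* Perm ℕ
  /-- there is room for moving the letters `1, …, 4` to `5, …, 8`, with two letters to spare that
  adjust the parity of permutations -/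
  eleven_le : ∀ n, 11 ≤ m n
  act_of_gt : ∀ n j, 4 < j → act n j = 1
  act_mem : ∀ n j h, act n j h ∈ evenPerms (m n)
  le_closure : ∀ n, evenPerms (m n) ≤ Subgroup.closure {σ | ∃ j h, j ≠ 0 ∧ σ = act n j h}
  /-- the actions at the levels beyond any given one are jointly faithful -/
  eq_one : ∀ n h, (∀ l j, n ≤ l → j ≠ 0 → act l j h = 1) → h = 1

namespace ActionData

variable {H : Type*} [Group H] (D : ActionData H)

/-- The underlying function of `ActionData.letter`. -/
def letterFun : List ℕ → ℕ → ℕ → H → List ℕ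
  | [], _, _, _ => []
  | a :: w, n, j, h => if j = 0 then a :: letterFun w (n + 1) a h else D.act n j h a :: w

lemma letterFun_one (w : List ℕ) (n j : ℕ) : D.letterFun w n j 1 = w := by
  induction w generalizing n j with
  | nil => rfl
  | cons a w ih => by_cases h : j = 0 <;> simp [letterFun, h, ih]

lemma letterFun_mul (w : List ℕ) (n j : ℕ) (h h' : H) :
    D.letterFun w n j (h * h') = D.letterFun (D.letterFun w n j h') n j h := by
  induction w generalizing n j with
  | nil => rfl
  | cons a w ih => by_cases hj : j = 0 <;> simp [letterFun, hj, ih]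

/-- The generators of the group acting on the tree below level `n`.  For `j ≠ 0` these are the
rooted permutations given by the `j`-th action.  For `j = 0` these are the directed permutations:
the element `h` fixes the first letter `a` and acts on the rest as `letter (n + 1) a h`; hence it
is directed along the word `000…`, and acts as a rooted permutation below the words `0…0a`
with `a ≠ 0`. -/
def letter (n j : ℕ) : H →* Perm (List ℕ) :=
  MonoidHom.toHomPerm
    { toFun := fun h w => D.letterFun w n j h
      map_one' := funext fun w => D.letterFun_one w n j
      map_mul' := fun h h' => funext fun w => D.letterFun_mul w n j h h' }

lemma letter_apply (n j : ℕ) (h : H) (w : List ℕ) : D.letter n j h w = D.letterFun w n j h := rfl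

lemma letter_of_ne {n j : ℕ} (hj : j ≠ 0) (h : H) : D.letter n j h = rooted (D.act n j h) := by
  ext1 w
  cases w with
  | nil => rfl
  | cons a w => rw [letter_apply, letterFun, if_neg hj, rooted_cons]

lemma letter_zero (n : ℕ) (h : H) :
    D.letter n 0 h = levelOne (fun a => D.letter (n + 1) a h) := by
  ext1 w
  cases w with
  | nil => rfl
  | cons a w => rw [letter_apply, letterFun, if_pos rfl, levelOne_cons, letter_apply]

lemma letter_of_gt {n j : ℕ} (hj : 4 < j) (h : H) : D.letter n j h = 1 := by
  rw [letter_of_ne D (by omega), D.act_of_gt n j hj, MonoidHom.one_apply, map_one]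

/-- The letters at level `n`, as a set of permutations. -/
def letters (n : ℕ) : Set (Perm (List ℕ)) := {g | ∃ j h, g = D.letter n j h}

/-- The group generated by all rooted and directed permutations at level `n`. -/
def grp (n : ℕ) : Subgroup (Perm (List ℕ)) := Subgroup.closure (D.letters n)

lemma letter_mem (n j : ℕ) (h : H) : D.letter n j h ∈ D.grp n :=
  Subgroup.subset_closure ⟨j, h, rfl⟩

lemma inv_mem_letters {n : ℕ} {g : Perm (List ℕ)} (hg : g ∈ D.letters n) :
    g⁻¹ ∈ D.letters n := by
  obtain ⟨j, h, rfl⟩ := hg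
  exact ⟨j, h⁻¹, (map_inv _ _).symm⟩

lemma rooted_mem {n : ℕ} {σ : Perm ℕ} (hσ : σ ∈ evenPerms (D.m n)) : rooted σ ∈ D.grp n := by
  have h := D.le_closure n hσ
  have : Subgroup.closure {σ | ∃ j h, j ≠ 0 ∧ σ = D.act n j h} ≤ (D.grp n).comap rooted := by
    rw [Subgroup.closure_le]
    rintro _ ⟨j, h, hj, rfl⟩
    change rooted _ ∈ D.grp n
    rw [← letter_of_ne D hj]
    exact D.letter_mem n j h
  exact this h

/-- Wreath recursion: the elements of the group at level `n` consist of an even permutation of the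
first letter and of sections in the group at level `n + 1`. -/
lemma exists_eq_wreath {n : ℕ} {g : Perm (List ℕ)} (hg : g ∈ D.grp n) :
    ∃ σ ∈ evenPerms (D.m n), ∃ s : ℕ → Perm (List ℕ), (∀ a, s a ∈ D.grp (n + 1)) ∧
      (∀ a, D.m n ≤ a → s a = 1) ∧ g = wreath σ s := by
  induction hg using Subgroup.closure_induction with
  | mem g hg =>
    obtain ⟨j, h, rfl⟩ := hg
    by_cases hj : j = 0
    · subst hj
      refine ⟨1, one_mem _, fun a => D.letter (n + 1) a h, fun a => D.letter_mem _ _ _, ?_, ?_⟩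
      · intro a ha
        have := D.eleven_le n
        exact letter_of_gt D (by omega) h
      · rw [letter_zero, levelOne_def]
    · exact ⟨_, D.act_mem n j h, fun _ => 1, fun _ => one_mem _, fun _ _ => rfl,
        letter_of_ne D hj h⟩
  | one => exact ⟨1, one_mem _, fun _ => 1, fun _ => one_mem _, fun _ _ => rfl, wreath_one.symm⟩
  | mul g g' _ _ ih ih' =>
    obtain ⟨σ, hσ, s, hs, hs1, rfl⟩ := ih
    obtain ⟨τ, hτ, t, ht, ht1, rfl⟩ := ih'
    refine ⟨_, mul_mem hσ hτ, fun a => s (τ a) * t a, fun a => mul_mem (hs _) (ht _), ?_,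
      wreath_mul _ _ _ _⟩
    intro a ha
    simp only
    rw [evenPerms_apply_of_le hτ ha, hs1 a ha, ht1 a ha, one_mul]
  | inv g _ ih =>
    obtain ⟨σ, hσ, s, hs, hs1, rfl⟩ := ih
    refine ⟨_, inv_mem hσ, _, fun a => inv_mem (hs (σ⁻¹ a)), ?_, wreath_inv _ _⟩
    intro a ha
    rw [evenPerms_apply_of_le (inv_mem hσ) ha, hs1 a ha, inv_one]

end ActionData

/-! ### Branching -/

/-- If a group `K` generated by `S` normalizes `N` and the commutators of the generators lie
in `N`, then all commutators of elements of `K` lie in `N`. -/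
lemma commutator_mem_of_closure {G : Type*} [Group G] {S : Set G} {N : Subgroup G}
    (hN : ∀ x ∈ Subgroup.closure S, ∀ y ∈ N, x * y * x⁻¹ ∈ N)
    (hS : ∀ s ∈ S, ∀ t ∈ S, s * t * s⁻¹ * t⁻¹ ∈ N) {x y : G} (hx : x ∈ Subgroup.closure S)
    (hy : y ∈ Subgroup.closure S) : x * y * x⁻¹ * y⁻¹ ∈ N := by
  have h1 : ∀ t ∈ S, ∀ x ∈ Subgroup.closure S, x * t * x⁻¹ * t⁻¹ ∈ N := by
    intro t ht x hx
    induction hx using Subgroup.closure_induction with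
    | mem x hx => exact hS x hx t ht
    | one => simp
    | mul x y hx _ ihx ihy =>
      have := mul_mem (hN x hx _ ihy) ihx
      convert this using 1; group
    | inv x hx ih =>
      have := hN _ (inv_mem hx) _ (inv_mem ih)
      convert this using 1; group
  induction hy using Subgroup.closure_induction with
  | mem y hy => exact h1 y hy x hx
  | one => simp
  | mul y z hy _ ihy ihz =>
    have := mul_mem ihy (hN y hy _ ihz)
    convert this using 1; group
  | inv y hy ih =>
    have := hN _ (inv_mem hy) _ (inv_mem ih)
    convert this using 1; group

/-- A letter `i ≤ 4` can be moved to `0` without moving any letter greater than `4` to a letter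
at most `4`; the parity is adjusted by means of the letters `9` and `10`. -/
lemma exists_evenPerms_inv_zero {m : ℕ} (hm : 11 ≤ m) {i : ℕ} (hi : i ≤ 4) :
    ∃ σ ∈ evenPerms m, σ⁻¹ 0 = i ∧ ∀ a, 4 < a → 4 < σ⁻¹ a := by
  by_cases h0 : i = 0
  · exact ⟨1, one_mem _, by simp [h0], fun a ha => by simpa using ha⟩
  · refine ⟨swap 0 i * swap 9 10, swap_mul_swap_mem_evenPerms (by omega) (by omega) (by omega)
      (by omega) (by omega) (by omega), ?_, ?_⟩
    · rw [mul_inv_rev, swap_inv, swap_inv, Perm.mul_apply, swap_apply_left,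
        swap_apply_of_ne_of_ne (by omega) (by omega)]
    · intro a ha
      rw [mul_inv_rev, swap_inv, swap_inv, Perm.mul_apply,
        swap_apply_of_ne_of_ne (a := 0) (by omega) (by omega), swap_apply_def]
      split_ifs <;> omega

/-- A letter `i ≤ 4` can be moved to `0` such that the other letters at most `4` are moved out of
the range `{1, …, 4}`, to `{5, …, 8}`. -/
lemma exists_evenPerms_inv_zero' {m : ℕ} (hm : 11 ≤ m) {i : ℕ} (hi : i ≤ 4) :
    ∃ σ ∈ evenPerms m, σ⁻¹ 0 = i ∧ ∀ a, a ≠ 0 → a ≤ 4 → 4 < σ⁻¹ a := by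
  obtain ⟨σ, hσ, h0, h4⟩ := exists_evenPerms_inv_zero hm hi
  refine ⟨swap 1 5 * swap 2 6 * (swap 3 7 * swap 4 8) * σ, mul_mem (mul_mem ?_ ?_) hσ, ?_, ?_⟩
  · exact swap_mul_swap_mem_evenPerms (by omega) (by omega) (by omega) (by omega) (by omega)
      (by omega)
  · exact swap_mul_swap_mem_evenPerms (by omega) (by omega) (by omega) (by omega) (by omega)
      (by omega)
  · rw [mul_inv_rev, Perm.mul_apply]
    have : (swap 1 5 * swap 2 6 * (swap 3 7 * swap 4 8) : Perm ℕ)⁻¹ 0 = 0 := by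
      rw [Perm.inv_eq_iff_eq]; decide
    rw [this, h0]
  · intro a ha0 ha
    rw [mul_inv_rev, Perm.mul_apply]
    apply h4
    have : (swap 1 5 * swap 2 6 * (swap 3 7 * swap 4 8) : Perm ℕ)⁻¹ a = a + 4 := by
      rw [Perm.inv_eq_iff_eq]
      interval_cases a
      · exact absurd rfl ha0
      all_goals decide
    omega

namespace ActionData

variable {H : Type*} [Group H] (D : ActionData H)

/-- Every generator at level `n + 1` is the section at `0` of a conjugate of a directed
permutation, whose other sections are nontrivial only below the letters `1, …, 4`, or
alternatively only below letters greater than `4`. -/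
lemma exists_levelOne_mem {n : ℕ} {x : Perm (List ℕ)} (hx : x ∈ D.letters (n + 1)) :
    (∃ s, levelOne s ∈ D.grp n ∧ s 0 = x ∧ ∀ a, 4 < a → s a = 1) ∧
    (∃ s, levelOne s ∈ D.grp n ∧ s 0 = x ∧ ∀ a, a ≠ 0 → a ≤ 4 → s a = 1) := by
  obtain ⟨i, h, rfl⟩ := hx
  by_cases hi : i ≤ 4
  · have key : ∀ σ ∈ evenPerms (D.m n),
        levelOne (fun a => D.letter (n + 1) (σ⁻¹ a) h) ∈ D.grp n := by
      intro σ hσ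
      have := rooted_conj_levelOne σ (fun a => D.letter (n + 1) a h)
      rw [← letter_zero] at this
      rw [← this]
      exact mul_mem (mul_mem (D.rooted_mem hσ) (D.letter_mem _ _ _)) (inv_mem (D.rooted_mem hσ))
    constructor
    · obtain ⟨σ, hσ, h0, h4⟩ := exists_evenPerms_inv_zero (D.eleven_le n) hi
      exact ⟨_, key σ hσ, by simp only [h0], fun a ha => letter_of_gt D (h4 a ha) h⟩
    · obtain ⟨σ, hσ, h0, h4⟩ := exists_evenPerms_inv_zero' (D.eleven_le n) hi
      exact ⟨_, key σ hσ, by simp only [h0], fun a ha ha' => letter_of_gt D (h4 a ha ha') h⟩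
  · rw [letter_of_gt D (by omega)]
    exact ⟨⟨1, by rw [map_one]; exact one_mem _, rfl, fun _ _ => rfl⟩,
      ⟨1, by rw [map_one]; exact one_mem _, rfl, fun _ _ _ => rfl⟩⟩

/-- The permutations whose copy below the letter `0` belongs to the group at level `n` are
normalized by the group at level `n + 1`, because every generator of the latter is the section at
`0` of an element of level `n` that fixes the first letters. -/
lemma conj_mem_comap_atLetter {n : ℕ} {x y : Perm (List ℕ)} (hx : x ∈ D.grp (n + 1))
    (hy : y ∈ (D.grp n).comap (atLetter 0)) : x * y * x⁻¹ ∈ (D.grp n).comap (atLetter 0) := by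
  have key : ∀ x ∈ D.letters (n + 1), ∀ y ∈ (D.grp n).comap (atLetter 0),
      x * y * x⁻¹ ∈ (D.grp n).comap (atLetter 0) := by
    intro x hx y hy
    obtain ⟨⟨s, hs, rfl, -⟩, -⟩ := D.exists_levelOne_mem hx
    have : levelOne s * atLetter 0 y * (levelOne s)⁻¹ = atLetter 0 (s 0 * y * (s 0)⁻¹) := by
      rw [atLetter_apply, atLetter_apply, ← map_inv, ← map_mul, ← map_mul]
      congr 1
      funext a
      by_cases ha : a = 0
      · subst ha; simp
      · simp [Pi.mulSingle_eq_of_ne ha]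
    change atLetter 0 _ ∈ D.grp n
    rw [← this]
    exact mul_mem (mul_mem hs hy) (inv_mem hs)
  have hle : D.grp (n + 1) ≤ Subgroup.normalizer ((D.grp n).comap (atLetter 0)) := by
    rw [grp, Subgroup.closure_le]
    intro x hx
    rw [SetLike.mem_coe, Subgroup.mem_normalizer_iff]
    refine fun y => ⟨key x hx y, fun h => ?_⟩
    have := key _ (D.inv_mem_letters hx) _ h
    convert this using 1; group
  exact (Subgroup.mem_normalizer_iff.1 (hle hx) y).1 hy

lemma commutator_letters_mem {n : ℕ} {x y : Perm (List ℕ)} (hx : x ∈ D.letters (n + 1))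
    (hy : y ∈ D.letters (n + 1)) : x * y * x⁻¹ * y⁻¹ ∈ (D.grp n).comap (atLetter 0) := by
  obtain ⟨⟨s, hs, rfl, hs1⟩, -⟩ := D.exists_levelOne_mem hx
  obtain ⟨-, ⟨t, ht, rfl, ht1⟩⟩ := D.exists_levelOne_mem hy
  have : levelOne s * levelOne t * (levelOne s)⁻¹ * (levelOne t)⁻¹ =
      atLetter 0 (s 0 * t 0 * (s 0)⁻¹ * (t 0)⁻¹) := by
    rw [atLetter_apply, ← map_inv, ← map_inv, ← map_mul, ← map_mul, ← map_mul]
    congr 1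
    funext a
    by_cases ha : a = 0
    · subst ha; simp
    · rw [Pi.mulSingle_eq_of_ne ha]
      by_cases ha4 : a ≤ 4
      · simp [ht1 a ha ha4]
      · simp [hs1 a (by omega)]
  change atLetter 0 _ ∈ D.grp n
  rw [← this]
  exact mul_mem (mul_mem (mul_mem hs ht) (inv_mem hs)) (inv_mem ht)

lemma commutator_mem_comap_atLetter {n : ℕ} {x y : Perm (List ℕ)} (hx : x ∈ D.grp (n + 1))
    (hy : y ∈ D.grp (n + 1)) : x * y * x⁻¹ * y⁻¹ ∈ (D.grp n).comap (atLetter 0) :=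
  commutator_mem_of_closure (fun _ hx _ hy => D.conj_mem_comap_atLetter hx hy)
    (fun _ hx _ hy => D.commutator_letters_mem hx hy) hx hy

/-- Rooted even permutations may be applied below a single letter, since 3-cycles are commutators
of 3-cycles. -/
lemma atLetter_rooted_mem {n a : ℕ} (ha : a < D.m n) {σ : Perm ℕ}
    (hσ : σ ∈ evenPerms (D.m (n + 1))) : atLetter a (rooted σ) ∈ D.grp n := by
  have hle : evenPerms (D.m (n + 1)) ≤ ((D.grp n).comap (atLetter 0)).comap rooted := by
    apply evenPerms_le_of_threeCycle
    intro a b c ha hb hc hab hbc hac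
    have h11 := D.eleven_le (n + 1)
    obtain ⟨d, hd, hda, hdb, hdc⟩ : ∃ d < D.m (n + 1), d ≠ a ∧ d ≠ b ∧ d ≠ c := by
      by_contra hcon
      push Not at hcon
      have h0 := hcon 0 (by omega)
      have h1 := hcon 1 (by omega)
      have h2 := hcon 2 (by omega)
      have h3 := hcon 3 (by omega)
      omega
    obtain ⟨e, he, hea, heb, hec, hed⟩ :
        ∃ e < D.m (n + 1), e ≠ a ∧ e ≠ b ∧ e ≠ c ∧ e ≠ d := by
      by_contra hcon
      push Not at hcon
      have h0 := hcon 0 (by omega)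
      have h1 := hcon 1 (by omega)
      have h2 := hcon 2 (by omega)
      have h3 := hcon 3 (by omega)
      have h4 := hcon 4 (by omega)
      omega
    have hcomm := threeCycle_eq_commutator (a := a) (b := b) (c := c) (d := d) (e := e)
      (by simp; omega)
    rw [Subgroup.mem_comap, ← hcomm, map_mul, map_mul, map_mul, map_inv, map_inv]
    exact D.commutator_mem_comap_atLetter (D.rooted_mem (threeCycle_mem ha hb hd hab hdb.symm))
      (D.rooted_mem (threeCycle_mem ha hc he hac hec.symm))
  have h0 : atLetter 0 (rooted σ) ∈ D.grp n := hle hσ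
  have h11 := D.eleven_le n
  obtain ⟨τ, hτ, rfl⟩ := evenPerms_exists_map (m := D.m n) (a := 0) (b := a) (by omega)
    (by omega) ha
  rw [← rooted_conj_atLetter]
  exact mul_mem (mul_mem (D.rooted_mem hτ) h0) (inv_mem (D.rooted_mem hτ))

/-- Directed permutations may be applied below the letter `0`: their remaining sections are rooted
and can be cancelled. -/
lemma atLetter_zero_letter_mem (n : ℕ) (h : H) :
    atLetter 0 (D.letter (n + 1) 0 h) ∈ D.grp n := by
  have h11 := D.eleven_le n
  -- the directed permutation at level `n` without its section at `0`
  have h1 : levelOne (Function.update (fun a => D.letter (n + 1) a h) 0 1) ∈ D.grp n := by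
    refine levelOne_mem (D.m n) (fun a ha => ?_) (fun a ha => ?_)
    · rw [Function.update_of_ne (by omega), letter_of_gt D (by omega)]
    · by_cases ha0 : a = 0
      · subst ha0; simp
      · rw [Function.update_of_ne ha0, letter_of_ne D ha0]
        exact D.atLetter_rooted_mem ha (D.act_mem _ _ _)
  have h2 : D.letter n 0 h = atLetter 0 (D.letter (n + 1) 0 h) *
      levelOne (Function.update (fun a => D.letter (n + 1) a h) 0 1) := by
    rw [letter_zero, atLetter_apply, ← map_mul]
    congr 1
    funext a
    by_cases ha : a = 0
    · subst ha; simp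
    · simp [ha]
  have h3 := D.letter_mem n 0 h
  rw [h2] at h3
  exact (Subgroup.mul_mem_cancel_right _ h1).1 h3

/-- The group at level `n` contains the group at level `n + 1`, acting below a single letter.
Hence it is the full permutational wreath product. -/
lemma atLetter_mem {n a : ℕ} (ha : a < D.m n) {g : Perm (List ℕ)} (hg : g ∈ D.grp (n + 1)) :
    atLetter a g ∈ D.grp n := by
  have h11 := D.eleven_le n
  have hle : D.grp (n + 1) ≤ (D.grp n).comap (atLetter 0) := by
    rw [grp, Subgroup.closure_le]
    rintro _ ⟨j, h, rfl⟩
    by_cases hj : j = 0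
    · subst hj; exact D.atLetter_zero_letter_mem n h
    · rw [letter_of_ne D hj]
      exact D.atLetter_rooted_mem (by omega) (D.act_mem _ _ _)
  have h0 : atLetter 0 g ∈ D.grp n := hle hg
  obtain ⟨τ, hτ, rfl⟩ := evenPerms_exists_map (m := D.m n) (a := 0) (b := a) (by omega)
    (by omega) ha
  rw [← rooted_conj_atLetter]
  exact mul_mem (mul_mem (D.rooted_mem hτ) h0) (inv_mem (D.rooted_mem hτ))

end ActionData

/-! ### Words over finite alphabets and the level actions -/

/-- The word `w` is a vertex of the tree below level `n`: its `i`-th letter is less than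
`m (n + i)`. -/
def IsWord (m : ℕ → ℕ) : ℕ → List ℕ → Prop
  | _, [] => True
  | n, a :: w => a < m n ∧ IsWord m (n + 1) w

lemma isWord_iff {m : ℕ → ℕ} {n : ℕ} {w : List ℕ} :
    IsWord m n w ↔ ∀ i (h : i < w.length), w[i] < m (n + i) := by
  induction w generalizing n with
  | nil => simp [IsWord]
  | cons a w ih =>
    rw [IsWord, ih]
    constructor
    · rintro ⟨h0, h1⟩ i hi
      cases i with
      | zero => exact h0
      | succ i =>
        have := h1 i (by simpa using hi)
        rwa [Nat.add_assoc, Nat.add_comm 1] at this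
    · intro h
      refine ⟨h 0 (by simp), fun i hi => ?_⟩
      have := h (i + 1) (by simpa using hi)
      rwa [← Nat.add_assoc, Nat.add_right_comm] at this

lemma isWord_replicate_zero {m : ℕ → ℕ} (hm : ∀ n, 0 < m n) (n l : ℕ) :
    IsWord m n (List.replicate l 0) := by
  rw [isWord_iff]; intro i hi; simpa using hm _

lemma finite_isWord (m : ℕ → ℕ) (n l : ℕ) : {w | IsWord m n w ∧ w.length = l}.Finite := by
  induction l generalizing n with
  | zero => exact (Set.finite_singleton []).subset fun w hw => List.length_eq_zero_iff.1 hw.2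
  | succ l ih =>
    refine (Set.Finite.image2 List.cons (Set.finite_lt_nat (m n)) (ih (n + 1))).subset ?_
    rintro w ⟨hw, hl⟩
    cases w with
    | nil => simp at hl
    | cons a w => exact ⟨a, hw.1, w, ⟨hw.2, by simpa using hl⟩, rfl⟩

instance (m : ℕ → ℕ) (n l : ℕ) : Finite {w // IsWord m n w ∧ w.length = l} :=
  (finite_isWord m n l).to_subtype

namespace ActionData

variable {H : Type*} [Group H] (D : ActionData H)

lemma apply_length {n : ℕ} {g : Perm (List ℕ)} (hg : g ∈ D.grp n) (w : List ℕ) :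
    (g w).length = w.length := by
  induction w generalizing n g with
  | nil => obtain ⟨σ, -, s, -, -, rfl⟩ := D.exists_eq_wreath hg; rfl
  | cons a w ih =>
    obtain ⟨σ, -, s, hs, -, rfl⟩ := D.exists_eq_wreath hg
    simp [ih (hs a)]

lemma apply_take {n : ℕ} {g : Perm (List ℕ)} (hg : g ∈ D.grp n) (w : List ℕ) (k : ℕ) :
    (g w).take k = g (w.take k) := by
  induction w generalizing n g k with
  | nil => obtain ⟨σ, -, s, -, -, rfl⟩ := D.exists_eq_wreath hg; simp
  | cons a w ih =>
    obtain ⟨σ, -, s, hs, -, rfl⟩ := D.exists_eq_wreath hg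
    cases k with
    | zero => rfl
    | succ k => simp [ih (hs a)]

lemma apply_nil {n : ℕ} {g : Perm (List ℕ)} (hg : g ∈ D.grp n) : g [] = [] := by
  obtain ⟨σ, -, s, -, -, rfl⟩ := D.exists_eq_wreath hg; rfl

lemma isWord_apply {n : ℕ} {g : Perm (List ℕ)} (hg : g ∈ D.grp n) (w : List ℕ) :
    IsWord D.m n (g w) ↔ IsWord D.m n w := by
  induction w generalizing n g with
  | nil => rw [D.apply_nil hg]
  | cons a w ih =>
    obtain ⟨σ, hσ, s, hs, -, rfl⟩ := D.exists_eq_wreath hg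
    rw [wreath_cons, IsWord, IsWord, ih (hs a), evenPerms_apply_lt hσ]

lemma m_pos (n : ℕ) : 0 < D.m n := by have := D.eleven_le n; omega

/-- The group acts faithfully on the tree with finite alphabets. -/
lemma eq_one_of_forall_isWord {n : ℕ} {g : Perm (List ℕ)} (hg : g ∈ D.grp n)
    (h : ∀ w, IsWord D.m n w → g w = w) : g = 1 := by
  ext1 w
  rw [Perm.one_apply]
  induction w generalizing n g with
  | nil => exact D.apply_nil hg
  | cons a w ih =>
    obtain ⟨σ, hσ, s, hs, hs1, rfl⟩ := D.exists_eq_wreath hg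
    rw [wreath_cons]
    by_cases ha : a < D.m n
    · have h1 : σ a = a := (List.cons.inj (h [a] ⟨ha, trivial⟩)).1
      rw [h1, ih (hs a) fun v hv => (List.cons.inj (h (a :: v) ⟨ha, hv⟩)).2]
    · rw [evenPerms_apply_of_le hσ (by omega), hs1 a (by omega), Perm.one_apply]

/-- The action on the finite set of words of a given length. -/
def levelAction (n l : ℕ) : D.grp n →* Perm {w // IsWord D.m n w ∧ w.length = l} where
  toFun g := Perm.subtypePerm g.1 fun w => by
    rw [D.isWord_apply g.2, D.apply_length g.2]
  map_one' := rfl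
  map_mul' _ _ := rfl

lemma levelAction_apply (n l : ℕ) (g : D.grp n) (w : {w // IsWord D.m n w ∧ w.length = l}) :
    (D.levelAction n l g w : List ℕ) = g.1 w := rfl

lemma exists_apply_eq {n : ℕ} {v w : List ℕ} (hv : IsWord D.m n v) (hw : IsWord D.m n w)
    (hl : v.length = w.length) : ∃ g ∈ D.grp n, g v = w := by
  induction v generalizing n w with
  | nil =>
    refine ⟨1, one_mem _, ?_⟩
    rw [Perm.one_apply]
    exact (List.length_eq_zero_iff.1 hl.symm).symm
  | cons a v ih =>
    cases w with
    | nil => simp at hl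
    | cons b w =>
      obtain ⟨g, hg, rfl⟩ := ih hv.2 hw.2 (by simpa using hl)
      have := D.eleven_le n
      obtain ⟨σ, hσ, rfl⟩ := evenPerms_exists_map (m := D.m n) (by omega) hv.1 hw.1
      refine ⟨rooted σ * atLetter a g, mul_mem (D.rooted_mem hσ) (D.atLetter_mem hv.1 hg), ?_⟩
      simp [atLetter_apply]

/-! ### Rigid stabilizers -/

/-- The permutation of words that applies a given permutation to the words below the word `v`
and fixes all words that do not start with `v`. -/
def _root_.atWord : List ℕ → Perm (List ℕ) →* Perm (List ℕ)
  | [] => MonoidHom.id _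
  | a :: v => (atLetter a).comp (atWord v)

lemma _root_.atWord_apply_of_not_prefix {v w : List ℕ} (h : ¬ v <+: w) (g : Perm (List ℕ)) :
    atWord v g w = w := by
  induction v generalizing w with
  | nil => exact absurd List.nil_prefix h
  | cons a v ih =>
    cases w with
    | nil => rfl
    | cons b w =>
      simp only [atWord, MonoidHom.comp_apply, atLetter_apply, levelOne_cons]
      by_cases hb : b = a
      · subst hb
        rw [Pi.mulSingle_eq_same, ih fun h' => h (List.cons_prefix_cons.2 ⟨rfl, h'⟩)]
      · rw [Pi.mulSingle_eq_of_ne hb, Perm.one_apply]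

lemma _root_.atWord_apply_self (v : List ℕ) {g : Perm (List ℕ)} (hg : g [] = []) :
    atWord v g v = v := by
  induction v with
  | nil => exact hg
  | cons a v ih =>
    simp only [atWord, MonoidHom.comp_apply, atLetter_apply, levelOne_cons, Pi.mulSingle_eq_same,
      ih]

lemma atWord_mem {n : ℕ} {v : List ℕ} (hv : IsWord D.m n v) {g : Perm (List ℕ)}
    (hg : g ∈ D.grp (n + v.length)) : atWord v g ∈ D.grp n := by
  induction v generalizing n with
  | nil => exact hg
  | cons a v ih =>
    refine D.atLetter_mem hv.1 (ih hv.2 ?_)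
    rwa [Nat.add_assoc, Nat.add_comm 1]

/-- An element that fixes all words of length `l` is a product of elements of the group at
level `n + l`, acting below these words. -/
lemma mem_closure_atWord {n l : ℕ} {g : Perm (List ℕ)} (hg : g ∈ D.grp n)
    (h : ∀ w, IsWord D.m n w → w.length = l → g w = w) :
    g ∈ Subgroup.closure
      {x | ∃ v, IsWord D.m n v ∧ v.length = l ∧ ∃ y ∈ D.grp (n + l), x = atWord v y} := by
  induction l generalizing n g with
  | zero => exact Subgroup.subset_closure ⟨[], trivial, rfl, g, hg, rfl⟩
  | succ l ih =>
    obtain ⟨σ, hσ, s, hs, hs1, rfl⟩ := D.exists_eq_wreath hg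
    have hσ1 : σ = 1 := by
      ext a
      rw [Perm.one_apply]
      by_cases ha : a < D.m n
      · exact (List.cons.inj (h (a :: List.replicate l 0)
          ⟨ha, isWord_replicate_zero D.m_pos _ _⟩ (by simp))).1
      · exact evenPerms_apply_of_le hσ (by omega)
    subst hσ1
    rw [← levelOne_def]
    refine levelOne_mem (D.m n) hs1 fun a ha => ?_
    have h1 := ih (hs a) fun w hw hwl => (List.cons.inj (h (a :: w) ⟨ha, hw⟩ (by simp [hwl]))).2
    rw [← Subgroup.mem_comap]
    refine (Subgroup.closure_le _).2 ?_ h1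
    rintro _ ⟨v, hv, hvl, y, hy, rfl⟩
    refine Subgroup.subset_closure ⟨a :: v, ⟨ha, hv⟩, by simp [hvl], y, ?_, rfl⟩
    rwa [Nat.add_assoc, Nat.add_comm 1] at hy

/-! ### The branch action on the rooted tree -/

/-- The word over `ℕ` that underlies a vertex of the rooted tree. -/
def _root_.TreeVertex.toList {m : ℕ → ℕ} (v : TreeVertex fun n => Fin (m n)) : List ℕ :=
  List.ofFn fun i => (v.2 i : ℕ)

lemma _root_.TreeVertex.length_toList {m : ℕ → ℕ} (v : TreeVertex fun n => Fin (m n)) :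
    v.toList.length = v.1 := by simp [TreeVertex.toList]

lemma _root_.TreeVertex.isWord_toList {m : ℕ → ℕ} (v : TreeVertex fun n => Fin (m n)) :
    IsWord m 0 v.toList := by
  rw [isWord_iff]
  intro i hi
  simp [TreeVertex.toList]

lemma _root_.TreeVertex.toList_injective {m : ℕ → ℕ} :
    Function.Injective (TreeVertex.toList (m := m)) := by
  rintro ⟨l, v⟩ ⟨l', v'⟩ h
  have hl := congrArg List.length h
  rw [TreeVertex.length_toList, TreeVertex.length_toList] at hl
  change l = l' at hl
  subst hl
  have := List.ofFn_injective h
  congr 1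
  funext i
  exact Fin.ext (congrFun this i)

lemma _root_.TreeVertex.exists_toList_eq {m : ℕ → ℕ} {w : List ℕ} (hw : IsWord m 0 w) :
    ∃ v : (i : Fin w.length) → Fin (m i),
      TreeVertex.toList (⟨w.length, v⟩ : TreeVertex fun n => Fin (m n)) = w := by
  rw [isWord_iff] at hw
  refine ⟨fun i => ⟨w[i], by simpa using hw i i.2⟩, ?_⟩
  simp [TreeVertex.toList]

/-- Vertices of the tree as words over `ℕ`. -/
noncomputable def _root_.vertexEquiv (m : ℕ → ℕ) :
    TreeVertex (fun n => Fin (m n)) ≃ {w // IsWord m 0 w} :=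
  Equiv.ofBijective (fun v => ⟨v.toList, v.isWord_toList⟩)
    ⟨fun _ _ h => TreeVertex.toList_injective (congrArg Subtype.val h), fun ⟨w, hw⟩ => by
      obtain ⟨v, hv⟩ := TreeVertex.exists_toList_eq hw
      exact ⟨_, Subtype.ext hv⟩⟩

lemma _root_.TreeVertex.toList_append {m : ℕ → ℕ} (v : TreeVertex fun n => Fin (m n))
    (x : Fin (m v.1)) : (v.append x).toList = v.toList ++ [(x : ℕ)] := by
  simp only [TreeVertex.toList, TreeVertex.append]
  rw [List.ofFn_succ', List.concat_eq_append]
  simp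

lemma _root_.TreeVertex.exists_append_iff {m : ℕ → ℕ} (v w : TreeVertex fun n => Fin (m n)) :
    (∃ x, w = v.append x) ↔
      w.toList.length = v.toList.length + 1 ∧ w.toList.take v.toList.length = v.toList := by
  constructor
  · rintro ⟨x, rfl⟩
    rw [TreeVertex.toList_append]
    simp
  · rintro ⟨hl, ht⟩
    have hw := w.isWord_toList
    rw [isWord_iff] at hw
    have hlt : v.toList.length < w.toList.length := by omega
    have hlast := (hw _ hlt).trans_eq
      (congrArg m ((Nat.zero_add _).trans v.length_toList))
    refine ⟨⟨_, hlast⟩, TreeVertex.toList_injective ?_⟩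
    rw [TreeVertex.toList_append]
    conv_lhs => rw [← List.take_append_drop v.toList.length w.toList, ht]
    rw [List.drop_eq_getElem_cons hlt, List.drop_eq_nil_of_le (by omega)]

lemma _root_.TreeVertex.isPrefix_iff {m : ℕ → ℕ} (v w : TreeVertex fun n => Fin (m n)) :
    v.IsPrefix w ↔ v.toList <+: w.toList := by
  rw [List.prefix_iff_getElem]
  constructor
  · rintro ⟨h, h'⟩
    refine ⟨by simpa [TreeVertex.length_toList] using h, fun i hi => ?_⟩
    have hi' : i < v.1 := by rwa [v.length_toList] at hi
    have := congrArg Fin.val (h' ⟨i, hi'⟩)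
    simpa [TreeVertex.toList] using this.symm
  · rintro ⟨h, h'⟩
    refine ⟨by simpa [TreeVertex.length_toList] using h, fun i => Fin.ext ?_⟩
    have := h' i (by rw [v.length_toList]; exact i.2)
    simp only [TreeVertex.toList, List.getElem_ofFn] at this
    exact this.symm

lemma apply_append_iff {n : ℕ} {g : Perm (List ℕ)} (hg : g ∈ D.grp n) (v w : List ℕ) :
    ((g w).length = (g v).length + 1 ∧ (g w).take (g v).length = g v) ↔
      (w.length = v.length + 1 ∧ w.take v.length = v) := by
  rw [D.apply_length hg, D.apply_length hg, D.apply_take hg, g.injective.eq_iff]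

/-- The action of the group at level `0` on the vertices of the rooted tree. -/
noncomputable def vertexPerm (g : D.grp 0) : Perm (TreeVertex fun n => Fin (D.m n)) :=
  (vertexEquiv D.m).symm.permCongr (Perm.subtypePerm g.1 fun w => D.isWord_apply g.2 w)

lemma toList_vertexPerm (g : D.grp 0) (v : TreeVertex fun n => Fin (D.m n)) :
    (D.vertexPerm g v).toList = g.1 v.toList := by
  have h : ∀ u : {w // IsWord D.m 0 w}, ((vertexEquiv D.m).symm u).toList = u.1 := fun u =>
    congrArg Subtype.val ((vertexEquiv D.m).apply_symm_apply u)
  rw [vertexPerm, Equiv.permCongr_apply, h]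
  rfl

/-- The action of the group at level `0` by automorphisms of the rooted tree. -/
noncomputable def toTreeAut : D.grp 0 →* TreeAut (fun n => Fin (D.m n)) where
  toFun g := ⟨⟨D.vertexPerm g, fun {v w} => by
    simp only [rootedTree, TreeVertex.exists_append_iff, toList_vertexPerm,
      D.apply_append_iff g.2]⟩, by
    apply TreeVertex.toList_injective
    refine (D.toList_vertexPerm g _).trans ?_
    exact D.apply_nil g.2⟩
  map_one' := by
    ext1; ext1 v
    apply TreeVertex.toList_injective
    exact D.toList_vertexPerm 1 v
  map_mul' g g' := by
    ext1; ext1 v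
    apply TreeVertex.toList_injective
    refine (D.toList_vertexPerm (g * g') v).trans ?_
    refine Eq.trans ?_ (D.toList_vertexPerm g (D.vertexPerm g' v)).symm
    rw [toList_vertexPerm]
    rfl

lemma toList_toTreeAut (g : D.grp 0) (v : TreeVertex fun n => Fin (D.m n)) :
    ((D.toTreeAut g).1 v).toList = g.1 v.toList := D.toList_vertexPerm g v

lemma toTreeAut_injective : Function.Injective D.toTreeAut := by
  rw [injective_iff_map_eq_one]
  intro g hg
  ext1
  refine D.eq_one_of_forall_isWord g.2 fun w hw => ?_
  obtain ⟨v, rfl⟩ : ∃ v : TreeVertex fun n => Fin (D.m n), v.toList = w :=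
    let ⟨_, h⟩ := TreeVertex.exists_toList_eq hw; ⟨_, h⟩
  rw [← toList_toTreeAut, hg]
  rfl

lemma isSphericallyTransitive : IsSphericallyTransitive D.toTreeAut.range := by
  intro l v w
  obtain ⟨g, hg, h⟩ := D.exists_apply_eq
    (TreeVertex.isWord_toList (⟨l, v⟩ : TreeVertex fun n => Fin (D.m n)))
    (TreeVertex.isWord_toList (⟨l, w⟩ : TreeVertex fun n => Fin (D.m n)))
    (by rw [TreeVertex.length_toList, TreeVertex.length_toList])
  refine ⟨_, ⟨⟨g, hg⟩, rfl⟩, TreeVertex.toList_injective ?_⟩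
  rw [toList_toTreeAut]
  exact h

lemma ker_levelAction_le (l : ℕ) : (D.levelAction 0 l).ker ≤
    (rigidLevelStabilizer D.toTreeAut.range l).comap D.toTreeAut := by
  intro g hg
  have h1 := D.mem_closure_atWord (l := l) g.2 fun w hw hl => by
    have : D.levelAction 0 l g = 1 := hg
    rw [← D.levelAction_apply 0 l g ⟨w, hw, hl⟩, this]
    rfl
  have hle : Subgroup.closure
      {x | ∃ v, IsWord D.m 0 v ∧ v.length = l ∧ ∃ y ∈ D.grp (0 + l), x = atWord v y} ≤
      ((rigidLevelStabilizer D.toTreeAut.range l).comap D.toTreeAut).map (D.grp 0).subtype := by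
    rw [Subgroup.closure_le]
    rintro _ ⟨v, hv, rfl, y, hy, rfl⟩
    have hmem := D.atWord_mem hv hy
    refine ⟨⟨_, hmem⟩, ?_, rfl⟩
    obtain ⟨u, hu⟩ := TreeVertex.exists_toList_eq hv
    change D.toTreeAut _ ∈ rigidLevelStabilizer _ _
    refine (le_iSup (fun u : (i : Fin v.length) → Fin (D.m i) =>
      rigidStabilizer D.toTreeAut.range ⟨v.length, u⟩) u) ?_
    refine ⟨⟨_, rfl⟩, TreeVertex.toList_injective ?_, fun w hw => TreeVertex.toList_injective ?_⟩
    · rw [toList_toTreeAut, hu]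
      exact atWord_apply_self v (D.apply_nil hy)
    · rw [toList_toTreeAut]
      rw [TreeVertex.isPrefix_iff, hu] at hw
      exact atWord_apply_of_not_prefix hw y
  obtain ⟨g', hg', h⟩ := hle h1
  rwa [← Subtype.ext h]

lemma isBranchSubgroup : IsBranchSubgroup D.toTreeAut.range := by
  refine ⟨D.isSphericallyTransitive, fun l => ?_⟩
  have h1 : ((rigidLevelStabilizer D.toTreeAut.range l).comap D.toTreeAut).FiniteIndex :=
    Subgroup.finiteIndex_of_le (D.ker_levelAction_le l)
  refine ⟨?_⟩
  have h2 := Subgroup.index_comap_of_surjective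
    ((rigidLevelStabilizer D.toTreeAut.range l).subgroupOf D.toTreeAut.range)
    D.toTreeAut.rangeRestrict_surjective
  rw [← h2]
  exact h1.index_ne_zero

theorem isBranchGroup : IsBranchGroup (D.grp 0) := by
  refine ⟨fun n => Fin (D.m n), fun n => inferInstance, fun n => ?_, D.toTreeAut.range,
    D.isBranchSubgroup, ⟨MonoidHom.ofInjective D.toTreeAut_injective⟩⟩
  have := D.eleven_le n
  exact Fin.nontrivial_iff_two_le.2 (by omega)

end ActionData

namespace ActionData

variable {H : Type*} [Group H] (D : ActionData H)

/-! ### Contraction and conjugacy -/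

/-- All sections of `g` at words of length `N` are directed permutations or rooted permutations. -/
def IsContracted : ℕ → ℕ → Perm (List ℕ) → Prop
  | 0, n, g => (∃ h, g = D.letter n 0 h) ∨ ∃ σ, g = rooted σ
  | N + 1, n, g => ∃ σ s, g = wreath σ s ∧ ∀ a, IsContracted N (n + 1) (s a)

lemma isContracted_zero_section {n : ℕ} (a : ℕ) (h : H) :
    D.IsContracted 0 (n + 1) (D.letter (n + 1) a h) := by
  by_cases ha : a = 0
  · subst ha; exact Or.inl ⟨h, rfl⟩
  · exact Or.inr ⟨_, letter_of_ne D ha h⟩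

lemma isContracted_zero_one (n : ℕ) : D.IsContracted 0 n 1 := Or.inr ⟨1, (map_one _).symm⟩

lemma IsContracted.succ {D : ActionData H} {N n : ℕ} {g : Perm (List ℕ)}
    (hg : D.IsContracted N n g) : D.IsContracted (N + 1) n g := by
  induction N generalizing n g with
  | zero =>
    obtain ⟨h, rfl⟩ | ⟨σ, rfl⟩ := hg
    · exact ⟨1, _, D.letter_zero n h, fun a => D.isContracted_zero_section a h⟩
    · exact ⟨σ, _, rfl, fun a => D.isContracted_zero_one _⟩
  | succ N ih =>
    obtain ⟨σ, s, rfl, hs⟩ := hg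
    exact ⟨σ, s, rfl, fun a => ih (hs a)⟩

lemma IsContracted.mono {D : ActionData H} {N N' n : ℕ} {g : Perm (List ℕ)}
    (hg : D.IsContracted N n g) (h : N ≤ N') : D.IsContracted N' n g := by
  induction h with
  | refl => exact hg
  | step _ ih => exact ih.succ

/-- The sections of a product of two rooted or directed permutations are again rooted or directed,
since a rooted permutation has trivial sections. -/
lemma IsContracted.mul {D : ActionData H} {N n : ℕ} {g g' : Perm (List ℕ)}
    (hg : D.IsContracted N n g) (hg' : D.IsContracted N n g') :
    D.IsContracted (N + 1) n (g * g') := by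
  induction N generalizing n g g' with
  | zero =>
    obtain ⟨h, rfl⟩ | ⟨σ, rfl⟩ := hg <;> obtain ⟨h', rfl⟩ | ⟨σ', rfl⟩ := hg'
    · rw [← map_mul]
      exact IsContracted.succ (N := 0) (Or.inl ⟨_, rfl⟩)
    · refine ⟨_, _, by rw [letter_zero, levelOne_def, rooted_def, wreath_mul], fun a => ?_⟩
      simpa using D.isContracted_zero_section _ h
    · refine ⟨_, _, by rw [letter_zero, levelOne_def, rooted_def, wreath_mul], fun a => ?_⟩
      simpa using D.isContracted_zero_section _ h'
    · rw [← map_mul]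
      exact IsContracted.succ (N := 0) (Or.inr ⟨_, rfl⟩)
  | succ N ih =>
    obtain ⟨σ, s, rfl, hs⟩ := hg
    obtain ⟨τ, t, rfl, ht⟩ := hg'
    exact ⟨_, _, wreath_mul _ _ _ _, fun a => ih (hs _) (ht _)⟩

lemma exists_isContracted {n : ℕ} {g : Perm (List ℕ)} (hg : g ∈ D.grp n) :
    ∃ N, D.IsContracted N n g := by
  have hlet : ∀ g ∈ D.letters n, D.IsContracted 0 n g := by
    rintro _ ⟨j, h, rfl⟩
    by_cases hj : j = 0
    · subst hj; exact Or.inl ⟨h, rfl⟩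
    · exact Or.inr ⟨_, letter_of_ne D hj h⟩
  induction hg using Subgroup.closure_induction'' with
  | mem x hx => exact ⟨0, hlet x hx⟩
  | inv_mem x hx => exact ⟨0, hlet _ (D.inv_mem_letters hx)⟩
  | one => exact ⟨0, D.isContracted_zero_one n⟩
  | mul g g' _ _ ih ih' =>
    obtain ⟨N, hN⟩ := ih
    obtain ⟨N', hN'⟩ := ih'
    exact ⟨_, (hN.mono (le_max_left N N')).mul (hN'.mono (le_max_right N N'))⟩

lemma letter_zero_injective (n : ℕ) : Function.Injective (D.letter n 0) := by
  rw [injective_iff_map_eq_one]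
  have key : ∀ k n h, D.letter n 0 h = 1 → ∀ j, j ≠ 0 → D.act (n + k + 1) j h = 1 := by
    intro k
    induction k with
    | zero =>
      intro n h hh j hj
      rw [letter_zero, levelOne_def, ← wreath_one] at hh
      have h1 := congrFun (wreath_injective hh).2 j
      rw [letter_of_ne D hj, rooted_def, ← wreath_one] at h1
      exact (wreath_injective h1).1
    | succ k ih =>
      intro n h hh j hj
      rw [letter_zero, levelOne_def, ← wreath_one] at hh
      have h1 := ih (n + 1) h (congrFun (wreath_injective hh).2 0) j hj
      rwa [Nat.add_assoc n 1 k, Nat.add_comm 1 k] at h1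
  intro h hh
  refine D.eq_one (n + 1) h fun l j hl hj => ?_
  obtain ⟨k, rfl⟩ := Nat.exists_eq_add_of_le hl
  rw [Nat.add_right_comm]
  exact key k n h hh j hj

/-- A permutation that conjugates nontrivial directed permutations into each other fixes the
letter `0`, and its section at `0` conjugates the sections of the directed permutations: all other
sections of directed permutations are rooted, and a directed permutation that is conjugate to a
rooted one is trivial. -/
lemma conj_section {n : ℕ} {σ : Perm ℕ} {s : ℕ → Perm (List ℕ)} {h h' : H} (hh : h' ≠ 1)
    (hs : ∀ a, ∃ τ t, s a = wreath τ t)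
    (hc : wreath σ s * D.letter n 0 h = D.letter n 0 h' * wreath σ s) :
    s 0 * D.letter (n + 1) 0 h = D.letter (n + 1) 0 h' * s 0 := by
  rw [letter_zero, letter_zero, levelOne_def, levelOne_def, wreath_mul, wreath_mul] at hc
  have h1 := congrFun (wreath_injective hc).2
  simp only [Perm.one_apply] at h1
  by_cases h0 : σ 0 = 0
  · have := h1 0
    rwa [h0] at this
  · exfalso
    have h2 := h1 (σ⁻¹ 0)
    have h3 : σ (σ⁻¹ 0) = 0 := by simp
    have h4 : σ⁻¹ 0 ≠ 0 := fun h5 => h0 (by rw [h5] at h3; exact h3)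
    obtain ⟨τ, t, ht⟩ := hs (σ⁻¹ 0)
    rw [h3, letter_of_ne D h4, ht, letter_zero, levelOne_def, rooted_def, wreath_mul,
      wreath_mul, one_mul] at h2
    have h5 := (wreath_injective h2).1
    have h6 : D.act (n + 1) (σ⁻¹ 0) h = 1 := by simpa using h5
    have h7 := h1 (σ⁻¹ 0)
    rw [h3, letter_of_ne D h4, h6, map_one, mul_one] at h7
    have h8 : D.letter (n + 1) 0 h' = 1 := by simpa using h7.symm
    exact hh (D.letter_zero_injective _ (h8.trans (map_one _).symm))

lemma IsContracted.exists_eq_wreath {D : ActionData H} {N n : ℕ} {g : Perm (List ℕ)}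
    (hg : D.IsContracted N n g) : ∃ σ s, g = wreath σ s := by
  obtain ⟨σ, s, h, -⟩ := hg.succ
  exact ⟨σ, s, h⟩

/-- Following the word `000…`, a permutation conjugating directed permutations into each other
becomes itself a directed permutation. -/
lemma isConj_of_isContracted {N n : ℕ} {x : Perm (List ℕ)} (hx : D.IsContracted N n x) {h h' : H}
    (hh : h' ≠ 1) (hc : x * D.letter n 0 h = D.letter n 0 h' * x) : IsConj h h' := by
  induction N generalizing n x with
  | zero =>
    obtain ⟨k, rfl⟩ | ⟨σ, rfl⟩ := hx
    · rw [← map_mul, ← map_mul] at hc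
      rw [isConj_iff]
      exact ⟨k, by rw [D.letter_zero_injective n hc]; group⟩
    · have := D.conj_section hh (fun _ => ⟨1, fun _ => 1, wreath_one.symm⟩) hc
      rw [one_mul, mul_one] at this
      rw [D.letter_zero_injective _ this]
  | succ N ih =>
    obtain ⟨σ, s, rfl, hs⟩ := hx
    exact ih (hs 0) (D.conj_section hh (fun a => (hs a).exists_eq_wreath) hc)

/-- The embedding of `H` by directed permutations. -/
def directed : H →* D.grp 0 := (D.letter 0 0).codRestrict (D.grp 0) (D.letter_mem 0 0)

theorem isFrattiniEmbedding_directed : IsFrattiniEmbedding D.directed := by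
  have hinj : Function.Injective D.directed := fun h h' e =>
    D.letter_zero_injective 0 (congrArg Subtype.val e)
  refine ⟨hinj, fun h h' => ⟨fun hc => D.directed.map_isConj hc, fun hc => ?_⟩⟩
  obtain ⟨x, hx⟩ := isConj_iff.1 hc
  by_cases h1 : h' = 1
  · subst h1
    rw [map_one, conj_eq_one_iff, map_eq_one_iff _ hinj] at hx
    rw [hx]
  · obtain ⟨N, hN⟩ := D.exists_isContracted x.2
    refine D.isConj_of_isContracted hN h1 ?_
    have := congrArg Subtype.val (mul_inv_eq_iff_eq_mul.1 hx)
    exact this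

end ActionData

/-! ### Even permutations from finite actions -/

lemma evenPerms_mono {m m' : ℕ} (h : m ≤ m') : evenPerms m ≤ evenPerms m' := by
  rw [evenPerms, Subgroup.closure_le]
  rintro _ ⟨a, b, c, d, ha, hb, hc, hd, hab, hcd, rfl⟩
  exact swap_mul_swap_mem_evenPerms (by omega) (by omega) (by omega) (by omega) hab hcd

/-- The underlying function of `doubled`. -/
def doubledFun {d : ℕ} (σ : Perm (Fin d)) (x : ℕ) : ℕ :=
  if h : x / 2 < d then 2 * σ ⟨x / 2, h⟩ + x % 2 else x

/-- A permutation of `{0, …, d - 1}`, acting simultaneously on the even and on the odd elements of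
`{0, …, 2 d - 1}`.  Such permutations are always even. -/
def doubled (d : ℕ) : Perm (Fin d) →* Perm ℕ :=
  MonoidHom.toHomPerm
    { toFun := doubledFun
      map_one' := by
        funext x
        simp only [doubledFun, Perm.one_apply]
        split_ifs
        · exact Nat.div_add_mod x 2
        · rfl
      map_mul' := fun σ τ => by
        funext x
        change doubledFun (σ * τ) x = doubledFun σ (doubledFun τ x)
        simp only [doubledFun, Perm.mul_apply]
        by_cases h : x / 2 < d
        · have h1 : (2 * (τ ⟨x / 2, h⟩ : ℕ) + x % 2) / 2 = τ ⟨x / 2, h⟩ := by omega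
          have h2 : (2 * (τ ⟨x / 2, h⟩ : ℕ) + x % 2) % 2 = x % 2 := by omega
          simp [h, h1, h2]
        · simp [h] }

lemma doubled_apply {d : ℕ} (σ : Perm (Fin d)) (x : ℕ) : doubled d σ x = doubledFun σ x := rfl

lemma doubled_swap {d : ℕ} {i j : Fin d} (hij : i ≠ j) :
    doubled d (swap i j) = swap (2 * (i : ℕ)) (2 * j) * swap (2 * (i : ℕ) + 1) (2 * j + 1) := by
  ext x
  have hij' : (i : ℕ) ≠ j := fun h => hij (Fin.ext h)
  have hi := i.2
  have hj := j.2
  rw [doubled_apply, doubledFun, Perm.mul_apply]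
  by_cases hx : x / 2 < d
  · rw [dif_pos hx]
    simp only [swap_apply_def, Fin.ext_iff, apply_ite Fin.val]
    split_ifs <;> omega
  · rw [dif_neg hx, swap_apply_of_ne_of_ne (a := 2 * (i : ℕ) + 1), swap_apply_of_ne_of_ne] <;> omega

lemma doubled_mem {d : ℕ} (σ : Perm (Fin d)) : doubled d σ ∈ evenPerms (2 * d) := by
  induction σ using Perm.swap_induction_on with
  | one => rw [map_one]; exact one_mem _
  | swap_mul f x y hxy ih =>
    rw [map_mul, doubled_swap hxy]
    have hxy' : (x : ℕ) ≠ y := fun h => hxy (Fin.ext h)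
    exact mul_mem (swap_mul_swap_mem_evenPerms (by omega) (by omega) (by omega) (by omega)
      (by omega) (by omega)) ih

lemma doubled_injective (d : ℕ) : Function.Injective (doubled d) := by
  intro σ τ h
  ext i
  have := congrArg (fun ρ : Perm ℕ => ρ (2 * i)) h
  have h1 : (2 * (i : ℕ)) / 2 < d := by omega
  have h2 : (⟨(2 * (i : ℕ)) / 2, h1⟩ : Fin d) = i := Fin.ext (by simp)
  simp only [doubled_apply, doubledFun, h1, dif_pos, h2] at this
  omega

/-- The underlying function of `blockRot`. -/
def blockRotFun (o q e x : ℕ) : ℕ :=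
  if o ≤ x ∧ x < o + 3 * q then o + 3 * ((x - o) / 3) + ((x - o) % 3 + e) % 3 else x

lemma zmod_three_lt (e : Multiplicative (ZMod 3)) : (e.toAdd).val < 3 := ZMod.val_lt _

/-- The group of order 3 rotating each of the `q` consecutive blocks of length 3 that start
at `o`. -/
def blockRot (o q : ℕ) : Multiplicative (ZMod 3) →* Perm ℕ :=
  MonoidHom.toHomPerm
    { toFun := fun e => blockRotFun o q e.toAdd.val
      map_one' := by
        funext x
        simp only [blockRotFun, toAdd_one, ZMod.val_zero, Function.End.one_def, id]
        split_ifs <;> omega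
      map_mul' := fun e e' => by
        funext x
        have h1 := zmod_three_lt e
        have h2 := zmod_three_lt e'
        change blockRotFun o q (e * e').toAdd.val x =
          blockRotFun o q e.toAdd.val (blockRotFun o q e'.toAdd.val x)
        simp only [blockRotFun, toAdd_mul, ZMod.val_add]
        generalize (e.toAdd).val = a at *
        generalize (e'.toAdd).val = b at *
        split_ifs <;> omega }

lemma blockRot_apply (o q : ℕ) (e : Multiplicative (ZMod 3)) (x : ℕ) :
    blockRot o q e x = blockRotFun o q e.toAdd.val x := rfl

lemma val_ofAdd_one : ((Multiplicative.ofAdd (1 : ZMod 3)).toAdd).val = 1 := rfl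

lemma blockRot_succ (o q : ℕ) : blockRot o (q + 1) (Multiplicative.ofAdd 1) =
    blockRot o q (Multiplicative.ofAdd 1) *
      threeCycle (o + 3 * q) (o + 3 * q + 1) (o + 3 * q + 2) := by
  ext x
  rw [Perm.mul_apply, blockRot_apply, blockRot_apply, val_ofAdd_one, blockRotFun, blockRotFun,
    threeCycle, Perm.mul_apply]
  simp only [swap_apply_def]
  split_ifs <;> omega

lemma blockRot_mem (o q : ℕ) (e : Multiplicative (ZMod 3)) :
    blockRot o q e ∈ evenPerms (o + 3 * q) := by
  have h1 : blockRot o q (Multiplicative.ofAdd 1) ∈ evenPerms (o + 3 * q) := by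
    induction q with
    | zero =>
      have : blockRot o 0 (Multiplicative.ofAdd 1) = 1 := by
        ext x
        rw [blockRot_apply, blockRotFun, if_neg (by omega)]
        rfl
      rw [this]; exact one_mem _
    | succ q ih =>
      rw [blockRot_succ]
      exact mul_mem (evenPerms_mono (by omega) ih)
        (threeCycle_mem (by omega) (by omega) (by omega) (by omega) (by omega))
  have h2 : e = Multiplicative.ofAdd 1 ^ (e.toAdd).val := by
    rw [← ofAdd_nsmul]
    simp
  rw [h2, map_pow]
  exact pow_mem h1 _

lemma blockRot_injective (o : ℕ) {q : ℕ} (hq : 0 < q) : Function.Injective (blockRot o q) := by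
  rw [injective_iff_map_eq_one]
  intro e he
  have := congrArg (fun ρ : Perm ℕ => ρ o) he
  have h3 := zmod_three_lt e
  simp only [blockRot_apply, blockRotFun, Perm.one_apply] at this
  rw [if_pos (by omega)] at this
  have h0 : (e.toAdd).val = 0 := by omega
  exact (ZMod.val_eq_zero _).1 h0

/-- The rotations of blocks that start at `2`, the rotations of blocks that start at `3`, and one
3-cycle generate all even permutations: they move `j` to `j + 1` and fix `0` and `1`. -/
lemma evenPerms_le_of_blockRot {q : ℕ} {K : Subgroup (Perm ℕ)}
    (h0 : blockRot 0 1 (Multiplicative.ofAdd 1) ∈ K)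
    (h2 : blockRot 2 q (Multiplicative.ofAdd 1) ∈ K)
    (h3 : blockRot 3 q (Multiplicative.ofAdd 1) ∈ K) : evenPerms (3 * q + 3) ≤ K := by
  apply evenPerms_le_of_threeCycle_zero_one
  intro j hj
  induction j, hj using Nat.le_induction with
  | base =>
    intro _
    rw [blockRot_succ] at h0
    have : blockRot 0 0 (Multiplicative.ofAdd 1) = 1 := by
      ext x
      rw [blockRot_apply, blockRotFun, if_neg (by omega)]
      rfl
    rwa [this, one_mul] at h0
  | succ j hj ih =>
    intro hjq
    have key : ∀ o, (o = 2 ∨ o = 3) → blockRot o q (Multiplicative.ofAdd 1) ∈ K →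
        o ≤ j → (j - o) % 3 ≠ 2 → j < o + 3 * q → threeCycle 0 1 (j + 1) ∈ K := by
      intro o ho hoK hoj hj2 hjq
      have := mul_mem (mul_mem hoK (ih (by omega))) (inv_mem hoK)
      rw [conj_threeCycle] at this
      simp only [blockRot_apply, val_ofAdd_one, blockRotFun] at this
      rw [if_neg (by omega), if_neg (by omega), if_pos (by omega)] at this
      convert this using 2
      omega
    by_cases hj2 : (j - 2) % 3 = 2
    · exact key 3 (Or.inr rfl) h3 (by omega) (by omega) (by omega)
    · exact key 2 (Or.inl rfl) h2 (by omega) (by omega) (by omega)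

/-! ### The construction for a residually finite group -/

/-- The group whose three factors of order three are used to generate all even permutations. -/
abbrev RotGroup : Type := Fin 3 → Multiplicative (ZMod 3)

section

variable {G : Type*} [Group G] (d : ℕ → ℕ) (f : ∀ n, G →* Perm (Fin (d n)))

/-- The actions of `G × RotGroup` at level `n`, where `G` acts on `{0, …, 2 d n - 1}` by `f n` and
where the alphabet has size `3 (d n + 3) + 3`. -/
def rotAct (n : ℕ) : ℕ → G × RotGroup →* Perm ℕ
  | 1 => (doubled (d n)).comp ((f n).comp (MonoidHom.fst G RotGroup))
  | 2 => (blockRot 0 1).comp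
      ((Pi.evalMonoidHom _ (0 : Fin 3)).comp (MonoidHom.snd G RotGroup))
  | 3 => (blockRot 2 (d n + 3)).comp
      ((Pi.evalMonoidHom _ (1 : Fin 3)).comp (MonoidHom.snd G RotGroup))
  | 4 => (blockRot 3 (d n + 3)).comp
      ((Pi.evalMonoidHom _ (2 : Fin 3)).comp (MonoidHom.snd G RotGroup))
  | _ => 1

/-- The action data of `G × RotGroup` for a sequence of finite actions of `G` such that every
nontrivial element of `G` acts nontrivially infinitely often. -/
def rotData (hf : ∀ g ≠ 1, ∀ N, ∃ n, N ≤ n ∧ f n g ≠ 1) : ActionData (G × RotGroup) where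
  m n := 3 * (d n + 3) + 3
  act := rotAct d f
  eleven_le n := by omega
  act_of_gt n j hj := by
    match j, hj with
    | j + 5, _ => rfl
  act_mem n j h := by
    match j with
    | 0 => exact one_mem _
    | 1 => exact evenPerms_mono (by omega) (doubled_mem (f n h.1))
    | 2 => exact evenPerms_mono (by omega) (blockRot_mem _ _ (h.2 0))
    | 3 => exact evenPerms_mono (by omega) (blockRot_mem _ _ (h.2 1))
    | 4 => exact evenPerms_mono (by omega) (blockRot_mem _ _ (h.2 2))
    | j + 5 => exact one_mem _
  le_closure n := by
    apply evenPerms_le_of_blockRot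
    · exact Subgroup.subset_closure
        ⟨2, (1, fun _ => Multiplicative.ofAdd 1), by omega, rfl⟩
    · exact Subgroup.subset_closure
        ⟨3, (1, fun _ => Multiplicative.ofAdd 1), by omega, rfl⟩
    · exact Subgroup.subset_closure
        ⟨4, (1, fun _ => Multiplicative.ofAdd 1), by omega, rfl⟩
  eq_one n h hh := by
    refine Prod.ext ?_ (funext fun i => ?_)
    · by_contra hg
      obtain ⟨l, hl, hlg⟩ := hf h.1 hg n
      apply hlg
      apply doubled_injective
      rw [map_one]
      exact hh l 1 hl (by omega)
    · fin_cases i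
      · exact blockRot_injective 0 one_pos ((hh n 2 le_rfl (by omega)).trans (map_one _).symm)
      · exact blockRot_injective 2 (Nat.succ_pos (d n + 2))
          ((hh n 3 le_rfl (by omega)).trans (map_one _).symm)
      · exact blockRot_injective 3 (Nat.succ_pos (d n + 2))
          ((hh n 4 le_rfl (by omega)).trans (map_one _).symm)

/-- The generators of `G × RotGroup`: those of `G`, followed by those of the three factors. -/
def rotGen {N : ℕ} (s : Fin N → G) (i : ℕ) : G × RotGroup :=
  if h : i < N then (s ⟨i, h⟩, 1)
  else (1, fun k => if i = N + k then Multiplicative.ofAdd 1 else 1)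

/-- The generators of the branch group: the letters with `0 ≤ j ≤ 4` for the generators of the
acting group. -/
def branchGen (D : ActionData (G × RotGroup)) {N : ℕ} (s : Fin N → G)
    (e : Fin (5 * (N + 3))) : D.grp 0 :=
  ⟨D.letter 0 (e / (N + 3)) (rotGen s (e % (N + 3))), D.letter_mem _ _ _⟩

lemma closure_rotGen {N : ℕ} {s : Fin N → G} (hs : Subgroup.closure (Set.range s) = ⊤) :
    Subgroup.closure (rotGen s '' {i | i < N + 3}) = ⊤ := by
  set K := Subgroup.closure (rotGen s '' {i | i < N + 3}) with hK
  have hmem : ∀ i < N + 3, rotGen s i ∈ K := fun i hi => Subgroup.subset_closure ⟨i, hi, rfl⟩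
  have h1 : ∀ g : G, (g, 1) ∈ K := by
    have : Subgroup.closure (Set.range s) ≤ K.comap (MonoidHom.inl G RotGroup) := by
      rw [Subgroup.closure_le]
      rintro _ ⟨i, rfl⟩
      have := hmem i (by omega)
      rw [rotGen, dif_pos i.2] at this
      exact this
    intro g
    exact this (hs ▸ Subgroup.mem_top g)
  have h2 : ∀ (k : Fin 3) (e : Multiplicative (ZMod 3)), (1, Pi.mulSingle k e) ∈ K := by
    intro k e
    have h3 := hmem (N + k) (by omega)
    rw [rotGen, dif_neg (by omega)] at h3
    have h4 : e = Multiplicative.ofAdd 1 ^ (e.toAdd).val := by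
      rw [← ofAdd_nsmul]
      simp
    have h5 : ((1, Pi.mulSingle k e) : G × RotGroup) = (1, fun k' : Fin 3 =>
        if N + (k : ℕ) = N + k' then Multiplicative.ofAdd (1 : ZMod 3) else 1) ^ (e.toAdd).val := by
      refine Prod.ext (one_pow _).symm (funext fun k' => ?_)
      rw [Prod.pow_snd, Pi.pow_apply]
      by_cases hk : k' = k
      · subst hk
        simp only [Pi.mulSingle_eq_same, if_true]
        exact h4
      · simp only
        rw [Pi.mulSingle_eq_of_ne hk, if_neg fun h => hk (Fin.ext (by omega)), one_pow]
    rw [h5]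
    exact pow_mem h3 _
  rw [eq_top_iff]
  rintro ⟨g, p⟩ -
  have h6 : ((g, p) : G × RotGroup) = (g, 1) * ((1, Pi.mulSingle 0 (p 0)) *
      ((1, Pi.mulSingle 1 (p 1)) * (1, Pi.mulSingle 2 (p 2)))) := by
    refine Prod.ext (by simp) (funext fun k => ?_)
    fin_cases k <;> simp
  rw [h6]
  exact mul_mem (h1 g) (mul_mem (h2 _ _) (mul_mem (h2 _ _) (h2 _ _)))

lemma closure_branchGen (D : ActionData (G × RotGroup)) {N : ℕ} {s : Fin N → G}
    (hs : Subgroup.closure (Set.range s) = ⊤) :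
    Subgroup.closure (Set.range (branchGen D s)) = ⊤ := by
  have h1 : ∀ j ≤ 4, ∀ h, (⟨D.letter 0 j h, D.letter_mem _ _ _⟩ : D.grp 0) ∈
      Subgroup.closure (Set.range (branchGen D s)) := by
    intro j hj h
    have hle : Subgroup.closure (rotGen s '' {i | i < N + 3}) ≤
        (Subgroup.closure (Set.range (branchGen D s))).comap
          ((D.letter 0 j).codRestrict (D.grp 0) (D.letter_mem 0 j)) := by
      rw [Subgroup.closure_le]
      rintro _ ⟨i, hi, rfl⟩
      change i < N + 3 at hi
      refine Subgroup.subset_closure ⟨⟨i + (N + 3) * j, by nlinarith⟩, ?_⟩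
      simp only [branchGen, Nat.add_mul_mod_self_left, Nat.mod_eq_of_lt hi,
        Nat.add_mul_div_left i j (Nat.succ_pos (N + 2)), Nat.div_eq_of_lt hi, zero_add]
      rfl
    exact hle (closure_rotGen hs ▸ Subgroup.mem_top h)
  have h2 : D.grp 0 ≤ (Subgroup.closure (Set.range (branchGen D s))).map (D.grp 0).subtype := by
    conv_lhs => rw [ActionData.grp]
    rw [Subgroup.closure_le]
    rintro _ ⟨j, h, rfl⟩
    by_cases hj : j ≤ 4
    · exact ⟨_, h1 j hj h, rfl⟩
    · rw [D.letter_of_gt (by omega)]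
      exact one_mem _
  rw [eq_top_iff]
  intro g _
  obtain ⟨g', hg', h⟩ := h2 g.2
  rwa [← Subtype.ext h]

lemma isFrattiniEmbedding_inl {P : Type*} [Group P] :
    IsFrattiniEmbedding (MonoidHom.inl G P) := by
  refine ⟨fun g h e => congrArg Prod.fst e, fun g h => ⟨fun hc => MonoidHom.map_isConj _ hc,
    fun hc => ?_⟩⟩
  exact MonoidHom.map_isConj (MonoidHom.fst G P) hc

lemma IsFrattiniEmbedding.comp {G₁ G₂ G₃ : Type*} [Group G₁] [Group G₂] [Group G₃]
    {φ : G₂ →* G₃} {ψ : G₁ →* G₂} (hφ : IsFrattiniEmbedding φ) (hψ : IsFrattiniEmbedding ψ) :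
    IsFrattiniEmbedding (φ.comp ψ) :=
  ⟨hφ.1.comp hψ.1, fun g h => (hψ.2 g h).trans (hφ.2 _ _)⟩

end

lemma exists_generators (G : Type*) [Group G] (hfg : Group.FG G) :
    ∃ (N : ℕ) (s : Fin N → G), Subgroup.closure (Set.range s) = ⊤ := by
  obtain ⟨S, hS, hfin⟩ := Group.fg_iff.1 hfg
  obtain ⟨N, s, -, rfl⟩ := hfin.fin_param
  exact ⟨N, s, hS⟩

lemma lift_surjective {G : Type*} [Group G] {N : ℕ} {s : Fin N → G}
    (hs : Subgroup.closure (Set.range s) = ⊤) : Function.Surjective (FreeGroup.lift s) := by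
  rw [← MonoidHom.range_eq_top, FreeGroup.range_lift_eq_closure, hs]

/-- A finitely generated residually finite group has a sequence of finite permutation actions such
that every nontrivial element acts nontrivially infinitely often. -/
lemma exists_actions {G : Type*} [Group G] (hfg : Group.FG G) (hrf : Group.ResiduallyFinite G) :
    ∃ (d : ℕ → ℕ) (f : ∀ n, G →* Perm (Fin (d n))),
      ∀ g ≠ 1, ∀ N, ∃ n, N ≤ n ∧ f n g ≠ 1 := by
  have hc : Countable G := by
    obtain ⟨N, s, hs⟩ := exists_generators G hfg
    have : Countable (FreeGroup (Fin N)) :=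
      Function.Surjective.countable (f := FreeGroup.mk) Quot.mk_surjective
    exact (lift_surjective hs).countable
  have h1 : ∀ g : G, ∃ (d : ℕ) (f : G →* Perm (Fin d)), g ≠ 1 → f g ≠ 1 := by
    intro g
    by_cases hg : g = 1
    · exact ⟨0, 1, fun h => absurd hg h⟩
    · obtain ⟨K, hK⟩ := Group.exists_finiteIndexNormalSubgroup_notMem g hg
      have : Finite (G ⧸ K.toSubgroup) := inferInstance
      obtain ⟨d, ⟨e⟩⟩ := Finite.exists_equiv_fin (G ⧸ K.toSubgroup)
      refine ⟨d, e.permCongrHom.toMonoidHom.comp (MulAction.toPermHom G (G ⧸ K.toSubgroup)),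
        fun _ h => hK ?_⟩
      have h2 : MulAction.toPermHom G (G ⧸ K.toSubgroup) g = 1 :=
        e.permCongrHom.injective (h.trans (map_one _).symm)
      have h3 : g • ((1 : G) : G ⧸ K.toSubgroup) = ((1 : G) : G ⧸ K.toSubgroup) :=
        congrArg (fun σ : Perm (G ⧸ K.toSubgroup) => σ ((1 : G) : G ⧸ K.toSubgroup)) h2
      rw [MulAction.Quotient.smul_coe, smul_eq_mul, mul_one, QuotientGroup.eq, mul_one,
        inv_mem_iff] at h3
      exact h3
  obtain ⟨u, hu⟩ := exists_surjective_nat G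
  choose d f hf using h1
  refine ⟨fun n => d (u n.unpair.1), fun n => f (u n.unpair.1), fun g hg N => ?_⟩
  obtain ⟨k, rfl⟩ := hu g
  refine ⟨Nat.pair k N, Nat.right_le_pair k N, ?_⟩
  have e : (Nat.pair k N).unpair.1 = k := by rw [Nat.unpair_pair]
  change f (u (Nat.pair k N).unpair.1) (u k) ≠ 1
  generalize (Nat.pair k N).unpair.1 = k' at e
  subst e
  exact hf _ hg

lemma fg_grp {G : Type*} [Group G] (D : ActionData (G × RotGroup)) (hfg : Group.FG G) :
    Group.FG (D.grp 0) := by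
  obtain ⟨N, s, hs⟩ := exists_generators G hfg
  exact Group.fg_iff.2 ⟨_, closure_branchGen D hs, Set.finite_range _⟩

/-! ### Recursively enumerable word problems -/

section Stages

open Encodable Nat.Partrec

variable {α β : Type*} [Primcodable α] [Primcodable β]

lemma Partrec.exists_code {f : α →. β} (hf : Partrec f) :
    ∃ c : Code, ∀ a, c.eval (encode a) = (f a).map encode := by
  obtain ⟨c, hc⟩ := Code.exists_code.1 hf
  refine ⟨c, fun a => ?_⟩
  rw [hc]
  simp

/-- A recursively enumerable predicate is the projection of a primitive recursive relation. -/
lemma REPred.exists_stage {p : α → Prop} (hp : REPred p) :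
    ∃ q : α → ℕ → Prop, PrimrecRel q ∧ (∀ a t t', t ≤ t' → q a t → q a t') ∧
      ∀ a, p a ↔ ∃ t, q a t := by
  obtain ⟨c, hc⟩ := Partrec.exists_code hp
  refine ⟨fun a t => (Code.evaln t c (encode a)).isSome = true, ?_, fun a t t' ht h => ?_,
    fun a => ?_⟩
  · exact Primrec.eq.comp (Primrec.option_isSome.comp (Code.primrec_evaln.comp
      ((Primrec.snd.pair (Primrec.const c)).pair (Primrec.encode.comp Primrec.fst))))
      (Primrec.const true)
  · obtain ⟨y, hy⟩ := Option.isSome_iff_exists.1 h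
    exact Option.isSome_iff_exists.2 ⟨y, Code.evaln_mono ht hy⟩
  · have h1 : p a ↔ (c.eval (encode a)).Dom := by
      rw [hc a]
      simp [Part.assert]
    rw [h1, Part.dom_iff_mem]
    constructor
    · rintro ⟨y, hy⟩
      obtain ⟨k, hk⟩ := Code.evaln_complete.1 hy
      exact ⟨k, Option.isSome_iff_exists.2 ⟨y, hk⟩⟩
    · rintro ⟨k, hk⟩
      obtain ⟨y, hy⟩ := Option.isSome_iff_exists.1 hk
      exact ⟨y, Code.evaln_complete.2 ⟨k, hy⟩⟩

/-- The projection of a primitive recursive relation is recursively enumerable. -/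
lemma PrimrecRel.rePred_exists {q : α → β → Prop} (hq : PrimrecRel q) :
    REPred fun a => ∃ b, q a b := by
  classical
  have h1 : Primrec₂ fun (a : α) (t : ℕ) =>
      (decode (α := β) t).elim false fun b => decide (q a b) := by
    refine (Primrec.option_casesOn (o := fun p : α × ℕ => decode (α := β) p.2)
      (f := fun _ => false) (g := fun p b => decide (q p.1 b))
      (Primrec.decode.comp Primrec.snd) (Primrec.const false) ?_).of_eq ?_
    · exact hq.decide.comp (Primrec.fst.comp Primrec.fst) Primrec.snd
    · intro p
      change _ = (decode (α := β) p.2).elim false fun b => decide (q p.1 b)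
      cases decode (α := β) p.2 <;> rfl
  have h2 := Partrec.dom_re (Partrec.rfind (h1.to_comp.partrec₂))
  refine h2.of_eq fun a => ?_
  rw [Nat.rfind_dom]
  constructor
  · rintro ⟨t, ht, -⟩
    rw [PFun.coe_val, Part.mem_some_iff] at ht
    cases h : decode (α := β) t with
    | none => simp [h] at ht
    | some b => exact ⟨b, by simpa [h] using ht⟩
  · rintro ⟨b, hb⟩
    refine ⟨encode b, ?_, fun _ => trivial⟩
    rw [PFun.coe_val, Part.mem_some_iff]
    simp [hb]

end Stages

lemma wordEval_eq {G : Type*} [Group G] {n : ℕ} (s : Fin n → G) (w : SymWord n) :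
    wordEval s w = FreeGroup.lift s (FreeGroup.mk w) := by
  rw [FreeGroup.lift_mk, wordEval]

lemma exists_mk_eq {α : Type*} (x : FreeGroup α) : ∃ w, FreeGroup.mk w = x := Quot.exists_rep x

lemma exists_wordEval {G : Type*} [Group G] {n : ℕ} {s : Fin n → G}
    (hs : Subgroup.closure (Set.range s) = ⊤) (g : G) : ∃ w, wordEval s w = g := by
  obtain ⟨x, rfl⟩ := lift_surjective hs g
  obtain ⟨w, rfl⟩ := exists_mk_eq x
  exact ⟨w, wordEval_eq s w⟩

/-- A group with a recursively enumerable word problem is recursively presented, by all words that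
represent the trivial element. -/
lemma isRecursivelyPresented_of_rePred {G : Type*} [Group G] {n : ℕ} {s : Fin n → G}
    (hs : Subgroup.closure (Set.range s) = ⊤) (h : REPred fun w : SymWord n => wordEval s w = 1) :
    IsRecursivelyPresented G := by
  refine ⟨n, _, h, ⟨?_⟩⟩
  have h1 : {r : FreeGroup (Fin n) | ∃ w, wordEval s w = 1 ∧ FreeGroup.mk w = r} =
      ((FreeGroup.lift s).ker : Set (FreeGroup (Fin n))) := by
    ext r
    constructor
    · rintro ⟨w, hw, rfl⟩
      rwa [wordEval_eq] at hw
    · intro hr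
      obtain ⟨w, rfl⟩ := exists_mk_eq r
      exact ⟨w, (wordEval_eq s w).trans hr, rfl⟩
  rw [h1]
  exact (QuotientGroup.quotientMulEquivOfEq (Subgroup.normalClosure_eq_self _)).trans
    (QuotientGroup.quotientKerEquivOfSurjective _ (lift_surjective hs))

lemma primrec_invRev {n : ℕ} : Primrec (FreeGroup.invRev (α := Fin n)) :=
  Primrec.list_reverse.comp (Primrec.list_map Primrec.id
    ((Primrec.fst.comp Primrec.snd).pair (Primrec.not.comp (Primrec.snd.comp Primrec.snd))))

lemma primrec_reduce {n : ℕ} : Primrec (FreeGroup.reduce (α := Fin n)) := by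
  have h := Primrec.list_rec (f := fun L : SymWord n => L) (g := fun _ => ([] : SymWord n))
    (h := fun _ p => List.casesOn p.2.2 [p.1] fun hd tl =>
      if p.1.1 = hd.1 ∧ p.1.2 = not hd.2 then tl else p.1 :: hd :: tl) Primrec.id
    (Primrec.const []) ?_
  · exact h.of_eq fun L => rfl
  · refine Primrec.list_casesOn (f := fun p : SymWord n × (Fin n × Bool) × SymWord n × SymWord n =>
      p.2.2.2) (g := fun p => [p.2.1]) (h := fun p q =>
        if p.2.1.1 = q.1.1 ∧ p.2.1.2 = not q.1.2 then q.2 else p.2.1 :: q.1 :: q.2) ?_ ?_ ?_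
    · exact Primrec.snd.comp (Primrec.snd.comp Primrec.snd)
    · exact Primrec.list_cons.comp (Primrec.fst.comp Primrec.snd) (Primrec.const [])
    · have hx : Primrec fun p : (SymWord n × (Fin n × Bool) × SymWord n × SymWord n) ×
          (Fin n × Bool) × SymWord n => p.1.2.1 :=
        Primrec.fst.comp (Primrec.snd.comp Primrec.fst)
      have hy : Primrec fun p : (SymWord n × (Fin n × Bool) × SymWord n × SymWord n) ×
          (Fin n × Bool) × SymWord n => p.2.1 := Primrec.fst.comp Primrec.snd
      have ht : Primrec fun p : (SymWord n × (Fin n × Bool) × SymWord n × SymWord n) ×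
          (Fin n × Bool) × SymWord n => p.2.2 := Primrec.snd.comp Primrec.snd
      refine Primrec.ite (PrimrecPred.and ?_ ?_) ht ?_
      · exact Primrec.eq.comp (Primrec.fst.comp hx) (Primrec.fst.comp hy)
      · exact Primrec.eq.comp (Primrec.snd.comp hx) (Primrec.not.comp (Primrec.snd.comp hy))
      · exact Primrec.list_cons.comp hx (Primrec.list_cons.comp hy ht)

/-- A product of conjugates of relators and of their inverses.  Each item of the list consists of a
conjugating word, a relator, a stage at which the relator is enumerated (which does not affect the
product, but makes it decidable whether the list is valid), and a sign. -/
def relatorProduct {n : ℕ} (L : List (SymWord n × SymWord n × ℕ × Bool)) : SymWord n :=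
  L.flatMap fun p => p.1 ++ (cond p.2.2.2 p.2.1 (FreeGroup.invRev p.2.1) ++ FreeGroup.invRev p.1)

lemma mk_relatorProduct_cons {n : ℕ} (p : SymWord n × SymWord n × ℕ × Bool)
    (L : List (SymWord n × SymWord n × ℕ × Bool)) :
    FreeGroup.mk (relatorProduct (p :: L)) =
      FreeGroup.mk p.1 * cond p.2.2.2 (FreeGroup.mk p.2.1) (FreeGroup.mk p.2.1)⁻¹ *
        (FreeGroup.mk p.1)⁻¹ * FreeGroup.mk (relatorProduct L) := by
  rw [relatorProduct, List.flatMap_cons, ← relatorProduct, ← FreeGroup.mul_mk, ← FreeGroup.mul_mk,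
    ← FreeGroup.mul_mk, FreeGroup.inv_mk]
  rcases p.2.2.2 with _ | _ <;> simp [FreeGroup.inv_mk]

lemma mk_relatorProduct_append {n : ℕ} (L L' : List (SymWord n × SymWord n × ℕ × Bool)) :
    FreeGroup.mk (relatorProduct (L ++ L')) =
      FreeGroup.mk (relatorProduct L) * FreeGroup.mk (relatorProduct L') := by
  rw [relatorProduct, List.flatMap_append, ← FreeGroup.mul_mk]; rfl

lemma primrec_relatorProduct {n : ℕ} : Primrec (relatorProduct (n := n)) := by
  refine Primrec.list_flatMap Primrec.id ?_
  have hp : Primrec fun p : List (SymWord n × SymWord n × ℕ × Bool) ×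
      (SymWord n × SymWord n × ℕ × Bool) => p.2 := Primrec.snd
  have h21 := Primrec.fst.comp (Primrec.snd.comp hp)
  exact Primrec.list_append.comp (Primrec.fst.comp hp) (Primrec.list_append.comp
    (Primrec.cond (Primrec.snd.comp (Primrec.snd.comp (Primrec.snd.comp hp))) h21
      (primrec_invRev.comp h21)) (primrec_invRev.comp (Primrec.fst.comp hp)))

lemma mem_normalClosure_iff {n : ℕ} {R : SymWord n → Prop} {q : SymWord n → ℕ → Prop}
    (hq : ∀ r, R r ↔ ∃ t, q r t) (x : FreeGroup (Fin n)) :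
    x ∈ Subgroup.normalClosure {r : FreeGroup (Fin n) | ∃ w, R w ∧ FreeGroup.mk w = r} ↔
      ∃ L : List (SymWord n × SymWord n × ℕ × Bool),
        (∀ p ∈ L, q p.2.1 p.2.2.1) ∧ x = FreeGroup.mk (relatorProduct L) := by
  set N := Subgroup.normalClosure {r : FreeGroup (Fin n) | ∃ w, R w ∧ FreeGroup.mk w = r}
  constructor
  · intro hx
    induction hx using Subgroup.closure_induction'' with
    | one => exact ⟨[], by simp, rfl⟩
    | mul x y _ _ ihx ihy =>
      obtain ⟨L, hL, rfl⟩ := ihx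
      obtain ⟨L', hL', rfl⟩ := ihy
      refine ⟨L ++ L', fun p hp => ?_, (mk_relatorProduct_append L L').symm⟩
      rcases List.mem_append.1 hp with h | h
      exacts [hL p h, hL' p h]
    | mem x hx =>
      obtain ⟨_, ⟨r, hr, rfl⟩, hc⟩ := Group.mem_conjugatesOfSet_iff.1 hx
      obtain ⟨c, rfl⟩ := isConj_iff.1 hc
      obtain ⟨c, rfl⟩ := exists_mk_eq c
      obtain ⟨t, ht⟩ := (hq r).1 hr
      refine ⟨[(c, r, t, true)], by simpa using ht, ?_⟩
      rw [mk_relatorProduct_cons]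
      change _ = _ * 1
      rw [mul_one]; rfl
    | inv_mem x hx =>
      obtain ⟨_, ⟨r, hr, rfl⟩, hc⟩ := Group.mem_conjugatesOfSet_iff.1 hx
      obtain ⟨c, rfl⟩ := isConj_iff.1 hc
      obtain ⟨c, rfl⟩ := exists_mk_eq c
      obtain ⟨t, ht⟩ := (hq r).1 hr
      refine ⟨[(c, r, t, false)], by simpa using ht, ?_⟩
      rw [mk_relatorProduct_cons]
      change _ = _ * 1
      rw [mul_one, conj_inv]; rfl
  · rintro ⟨L, hL, rfl⟩
    induction L with
    | nil => exact one_mem _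
    | cons p L ih =>
      rw [mk_relatorProduct_cons]
      refine mul_mem ?_ (ih fun p hp => hL p (List.mem_cons_of_mem _ hp))
      have h1 : FreeGroup.mk p.2.1 ∈ N := Subgroup.subset_normalClosure
        ⟨p.2.1, (hq _).2 ⟨_, hL p List.mem_cons_self⟩, rfl⟩
      refine Subgroup.normalClosure_normal.conj_mem _ ?_ _
      rcases p.2.2.2 with _ | _
      exacts [inv_mem h1, h1]

/-- In a recursively presented group, the word problem is recursively enumerable with respect to
every finite generating family, not just the one of the presentation. -/
lemma IsRecursivelyPresented.rePred {G : Type*} [Group G] (h : IsRecursivelyPresented G) {N : ℕ}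
    (s : Fin N → G) : REPred fun w : SymWord N => wordEval s w = 1 := by
  obtain ⟨n, R, hR, ⟨e⟩⟩ := h
  obtain ⟨q, hq, -, hRq⟩ := hR.exists_stage
  have hu : ∀ i, ∃ u : SymWord n, e (PresentedGroup.mk _ (FreeGroup.mk u)) = s i := by
    intro i
    obtain ⟨x, hx⟩ := PresentedGroup.mk_surjective _ (e.symm (s i))
    obtain ⟨u, rfl⟩ := exists_mk_eq x
    refine ⟨u, ?_⟩
    rw [hx, MulEquiv.apply_symm_apply]
  choose u hu using hu
  -- substitution of words over the given generators by words over those of the presentation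
  set sub : SymWord N → SymWord n := fun w =>
    w.flatMap fun p => cond p.2 (u p.1) (FreeGroup.invRev (u p.1)) with hsub
  have hsubp : Primrec sub := by
    refine Primrec.list_flatMap Primrec.id ?_
    have h1 : Primrec fun p : SymWord N × (Fin N × Bool) => u p.2.1 :=
      (Primrec.dom_finite u).comp (Primrec.fst.comp Primrec.snd)
    exact Primrec.cond (Primrec.snd.comp Primrec.snd) h1 (primrec_invRev.comp h1)
  have hsube : ∀ w, wordEval s w = e (PresentedGroup.mk _ (FreeGroup.mk (sub w))) := by
    intro w
    induction w with
    | nil =>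
      change 1 = e (PresentedGroup.mk _ 1)
      rw [map_one, map_one]
    | cons p w ih =>
      have h1 : wordEval s (p :: w) = cond p.2 (s p.1) (s p.1)⁻¹ * wordEval s w := by
        rw [wordEval, List.map_cons, List.prod_cons, ← wordEval]
      have h2 : sub (p :: w) = cond p.2 (u p.1) (FreeGroup.invRev (u p.1)) ++ sub w := rfl
      rw [h1, h2, ← FreeGroup.mul_mk, map_mul, map_mul, ih, ← hu p.1]
      rcases p.2 with _ | _
      · simp only [cond_false, ← FreeGroup.inv_mk, map_inv]
      · rfl
  have hrel : PrimrecRel fun (w : SymWord N) (L : List (SymWord n × SymWord n × ℕ × Bool)) =>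
      (∀ p ∈ L, q p.2.1 p.2.2.1) ∧
        FreeGroup.reduce (sub w) = FreeGroup.reduce (relatorProduct L) := by
    refine PrimrecPred.and ?_ ?_
    · have h1 : PrimrecPred fun p : SymWord n × SymWord n × ℕ × Bool => q p.2.1 p.2.2.1 :=
        PrimrecRel.comp hq (Primrec.fst.comp Primrec.snd)
          (Primrec.fst.comp (Primrec.snd.comp Primrec.snd))
      exact PrimrecPred.comp h1.forall_mem_list Primrec.snd
    · exact Primrec.eq.comp (primrec_reduce.comp (hsubp.comp Primrec.fst))
        (primrec_reduce.comp (primrec_relatorProduct.comp Primrec.snd))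
  refine hrel.rePred_exists.of_eq fun w => ?_
  rw [hsube, map_eq_one_iff e e.injective]
  have h3 : PresentedGroup.mk {r : FreeGroup (Fin n) | ∃ w, R w ∧ FreeGroup.mk w = r}
      (FreeGroup.mk (sub w)) = 1 ↔ FreeGroup.mk (sub w) ∈
        Subgroup.normalClosure {r : FreeGroup (Fin n) | ∃ w, R w ∧ FreeGroup.mk w = r} :=
    QuotientGroup.eq_one_iff _
  rw [h3, mem_normalClosure_iff hRq]
  exact exists_congr fun L => and_congr_right fun _ =>
    ⟨FreeGroup.reduce.exact, FreeGroup.reduce.sound⟩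

/-! ### Computing with words in rooted and directed permutations -/

/-- A code `(j, i, b)` for a rooted or directed permutation: `j` is the index of the action, `i`
that of a generator, and `b` is the sign of the exponent of this generator. -/
abbrev LetterCode : Type := ℕ × ℕ × Bool

/-- The element represented by a word in generators `t i` and their inverses, for a sequence `t`
of generators. -/
def genVal {H : Type*} [Group H] (t : ℕ → H) (w : List (ℕ × Bool)) : H :=
  (w.map fun p => cond p.2 (t p.1) (t p.1)⁻¹).prod

/-- One step of the wreath recursion on words: if letters of level `n` move the letters of the
alphabet as described by `φ`, this computes the image of the letter `x` under the word `u`, and a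
word representing the section of `u` at `x`. -/
def sectionStep (φ : ℕ → LetterCode → ℕ → ℕ) (n : ℕ) (u : List LetterCode) (x : ℕ) :
    ℕ × List LetterCode :=
  u.foldr (fun a st => (φ n a st.1, (if a.1 = 0 then [(st.1, a.2)] else []) ++ st.2)) (x, [])

/-- Iteration of the wreath recursion along a word `v`.  The state consists of the level, of a word
representing the section reached so far, and of the image of the part of `v` read so far. -/
def sectionRun (φ : ℕ → LetterCode → ℕ → ℕ) (st : ℕ × List LetterCode × List ℕ) (v : List ℕ) :
    ℕ × List LetterCode × List ℕ :=
  v.foldl (fun st x => (st.1 + 1, (sectionStep φ st.1 st.2.1 x).2,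
    st.2.2 ++ [(sectionStep φ st.1 st.2.1 x).1])) st

/-- The list of all words of length `l` over the alphabets `{0, …, m n - 1}`. -/
def levelWords (m : ℕ → ℕ) (l : ℕ) : List (List ℕ) :=
  Nat.rec [[]] (fun l L => L.flatMap fun v => (List.range (m l)).map fun x => v ++ [x]) l

section Primrec

variable {φ : ℕ → LetterCode → ℕ → ℕ}

lemma primrec_sectionStep (hφ : Primrec fun p : ℕ × LetterCode × ℕ => φ p.1 p.2.1 p.2.2) :
    Primrec fun p : ℕ × List LetterCode × ℕ => sectionStep φ p.1 p.2.1 p.2.2 := by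
  refine Primrec.list_foldr (f := fun p : ℕ × List LetterCode × ℕ => p.2.1)
    (g := fun p => (p.2.2, ([] : List LetterCode)))
    (h := fun p q => (φ p.1 q.1 q.2.1, (if q.1.1 = 0 then [(q.2.1, q.1.2)] else []) ++ q.2.2))
    (Primrec.fst.comp Primrec.snd)
    ((Primrec.snd.comp Primrec.snd).pair (Primrec.const [])) ?_
  have hx : Primrec fun p : (ℕ × List LetterCode × ℕ) × LetterCode × ℕ × List LetterCode =>
      p.2.2.1 := Primrec.fst.comp (Primrec.snd.comp Primrec.snd)
  have ha : Primrec fun p : (ℕ × List LetterCode × ℕ) × LetterCode × ℕ × List LetterCode =>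
      p.2.1 := Primrec.fst.comp Primrec.snd
  refine Primrec.pair ?_ ?_
  · exact hφ.comp ((Primrec.fst.comp Primrec.fst).pair (ha.pair hx))
  · refine Primrec.list_append.comp (Primrec.ite ?_ ?_ (Primrec.const []))
      (Primrec.snd.comp (Primrec.snd.comp Primrec.snd))
    · exact Primrec.eq.comp (Primrec.fst.comp ha) (Primrec.const 0)
    · exact Primrec.list_cons.comp (hx.pair (Primrec.snd.comp ha)) (Primrec.const [])

lemma primrec_sectionRun (hφ : Primrec fun p : ℕ × LetterCode × ℕ => φ p.1 p.2.1 p.2.2) :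
    Primrec₂ fun (u : List LetterCode) (v : List ℕ) => sectionRun φ (0, u, []) v := by
  refine Primrec.list_foldl (f := fun p : List LetterCode × List ℕ => p.2)
    (g := fun p => (0, p.1, ([] : List ℕ)))
    (h := fun _ q => (q.1.1 + 1, (sectionStep φ q.1.1 q.1.2.1 q.2).2,
      q.1.2.2 ++ [(sectionStep φ q.1.1 q.1.2.1 q.2).1])) Primrec.snd
    ((Primrec.const 0).pair (Primrec.fst.pair (Primrec.const []))) ?_
  have hst : Primrec fun p : (List LetterCode × List ℕ) ×
      ((ℕ × List LetterCode × List ℕ) × ℕ) => p.2.1 := Primrec.fst.comp Primrec.snd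
  have hstep : Primrec fun p : (List LetterCode × List ℕ) ×
      ((ℕ × List LetterCode × List ℕ) × ℕ) => sectionStep φ p.2.1.1 p.2.1.2.1 p.2.2 :=
    (primrec_sectionStep hφ).comp ((Primrec.fst.comp hst).pair
      ((Primrec.fst.comp (Primrec.snd.comp hst)).pair (Primrec.snd.comp Primrec.snd)))
  exact (Primrec.succ.comp (Primrec.fst.comp hst)).pair ((Primrec.snd.comp hstep).pair
    (Primrec.list_append.comp (Primrec.snd.comp (Primrec.snd.comp hst))
      (Primrec.list_cons.comp (Primrec.fst.comp hstep) (Primrec.const []))))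

lemma primrec_levelWords {m : ℕ → ℕ} (hm : Primrec m) : Primrec (levelWords m) := by
  refine Primrec.nat_rec₁ [[]] (f := fun l L => L.flatMap fun v =>
    (List.range (m l)).map fun x => v ++ [x]) ?_
  refine Primrec.list_flatMap (f := fun p : ℕ × List (List ℕ) => p.2) Primrec.snd ?_
  refine Primrec.list_map (f := fun p : (ℕ × List (List ℕ)) × List ℕ => List.range (m p.1.1))
    (Primrec.list_range.comp (hm.comp (Primrec.fst.comp Primrec.fst))) ?_
  exact Primrec.list_append.comp (Primrec.snd.comp Primrec.fst)
    (Primrec.list_cons.comp Primrec.snd (Primrec.const []))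

end Primrec

lemma isWord_append {m : ℕ → ℕ} {n : ℕ} {v w : List ℕ} :
    IsWord m n (v ++ w) ↔ IsWord m n v ∧ IsWord m (n + v.length) w := by
  induction v generalizing n with
  | nil => simp [IsWord]
  | cons a v ih =>
    rw [List.cons_append, IsWord, IsWord, ih, List.length_cons, and_assoc, Nat.add_assoc,
      Nat.add_comm 1]

lemma isWord_singleton {m : ℕ → ℕ} {n x : ℕ} : IsWord m n [x] ↔ x < m n :=
  ⟨fun h => h.1, fun h => ⟨h, trivial⟩⟩

lemma mem_levelWords {m : ℕ → ℕ} {l : ℕ} {v : List ℕ} :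
    v ∈ levelWords m l ↔ IsWord m 0 v ∧ v.length = l := by
  induction l generalizing v with
  | zero =>
    have h1 : v ∈ levelWords m 0 ↔ v = [] := List.mem_singleton
    rw [h1]
    constructor
    · rintro rfl; exact ⟨trivial, rfl⟩
    · exact fun h => List.length_eq_zero_iff.1 h.2
  | succ l ih =>
    have h1 : levelWords m (l + 1) = (levelWords m l).flatMap fun v =>
      (List.range (m l)).map fun x => v ++ [x] := rfl
    rw [h1, List.mem_flatMap]
    constructor
    · rintro ⟨w, hw, h⟩
      obtain ⟨x, hx, rfl⟩ := List.mem_map.1 h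
      obtain ⟨hw', rfl⟩ := ih.1 hw
      rw [isWord_append, isWord_singleton, zero_add]
      exact ⟨⟨hw', List.mem_range.1 hx⟩, by simp⟩
    · rintro ⟨hv, hl⟩
      rcases List.eq_nil_or_concat' v with rfl | ⟨w, x, rfl⟩
      · simp at hl
      · rw [isWord_append, isWord_singleton, zero_add] at hv
        have hwl : w.length = l := by simpa using hl
        refine ⟨w, ih.2 ⟨hv.1, hwl⟩, List.mem_map.2 ⟨x, List.mem_range.2 ?_, rfl⟩⟩
        rw [← hwl]; exact hv.2

lemma nodup_levelWords (m : ℕ → ℕ) (l : ℕ) : (levelWords m l).Nodup := by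
  induction l with
  | zero => exact List.nodup_singleton _
  | succ l ih =>
    have h1 : levelWords m (l + 1) = (levelWords m l).flatMap fun v =>
      (List.range (m l)).map fun x => v ++ [x] := rfl
    rw [h1, List.nodup_flatMap]
    refine ⟨fun v _ => List.nodup_range.map fun x y h => by simpa using h, ?_⟩
    refine ih.imp_of_mem fun {v w} _ _ hvw => ?_
    rw [Function.onFun, List.disjoint_left]
    intro a ha ha'
    obtain ⟨x, -, rfl⟩ := List.mem_map.1 ha
    obtain ⟨y, -, h⟩ := List.mem_map.1 ha'
    exact hvw (List.append_inj_left' h rfl).symm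

/-! ### Contraction of words -/

/-- A word all of whose letters are rooted, or all of whose letters are directed. -/
def IsPure (u : List LetterCode) : Prop := (∀ a ∈ u, a.1 ≠ 0) ∨ ∀ a ∈ u, a.1 = 0

/-- All sections of the word `u` at words of length `N` are pure. -/
def IsPureAt (φ : ℕ → LetterCode → ℕ → ℕ) : ℕ → ℕ → List LetterCode → Prop
  | 0, _, u => IsPure u
  | N + 1, n, u => ∀ x, IsPureAt φ N (n + 1) (sectionStep φ n u x).2

section Contraction

variable {φ : ℕ → LetterCode → ℕ → ℕ}

lemma sectionStep_append (n : ℕ) (u u' : List LetterCode) (x : ℕ) :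
    sectionStep φ n (u ++ u') x = ((sectionStep φ n u (sectionStep φ n u' x).1).1,
      (sectionStep φ n u (sectionStep φ n u' x).1).2 ++ (sectionStep φ n u' x).2) := by
  induction u with
  | nil => rfl
  | cons a u ih =>
    have h : ∀ v y, sectionStep φ n (a :: v) y = (φ n a (sectionStep φ n v y).1,
      (if a.1 = 0 then [((sectionStep φ n v y).1, a.2)] else []) ++ (sectionStep φ n v y).2) :=
      fun _ _ => rfl
    rw [List.cons_append, h, h, ih]
    simp

lemma sectionStep_of_rooted (n : ℕ) {u : List LetterCode} (hu : ∀ a ∈ u, a.1 ≠ 0) (x : ℕ) :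
    (sectionStep φ n u x).2 = [] := by
  induction u with
  | nil => rfl
  | cons a u ih =>
    change (if a.1 = 0 then _ else []) ++ (sectionStep φ n u x).2 = []
    rw [if_neg (hu a List.mem_cons_self), ih fun b hb => hu b (List.mem_cons_of_mem _ hb)]
    rfl

lemma sectionStep_of_directed (hφ : ∀ n a x, a.1 = 0 → φ n a x = x) (n : ℕ)
    {u : List LetterCode} (hu : ∀ a ∈ u, a.1 = 0) (x : ℕ) :
    sectionStep φ n u x = (x, u.map fun a => (x, a.2)) := by
  induction u with
  | nil => rfl
  | cons a u ih =>
    have ha := hu a List.mem_cons_self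
    change (φ n a (sectionStep φ n u x).1, (if a.1 = 0 then
      [((sectionStep φ n u x).1, a.2)] else []) ++ (sectionStep φ n u x).2) = _
    rw [if_pos ha, ih fun b hb => hu b (List.mem_cons_of_mem _ hb), hφ _ _ _ ha]
    rfl

lemma IsPure.sectionStep (hφ : ∀ n a x, a.1 = 0 → φ n a x = x) (n : ℕ) {u : List LetterCode}
    (hu : IsPure u) (x : ℕ) : IsPure (sectionStep φ n u x).2 := by
  rcases hu with hu | hu
  · rw [sectionStep_of_rooted n hu]
    exact Or.inl fun a ha => absurd ha List.not_mem_nil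
  · rw [sectionStep_of_directed hφ n hu]
    by_cases hx : x = 0
    · subst hx
      refine Or.inr fun a ha => ?_
      obtain ⟨b, -, rfl⟩ := List.mem_map.1 ha
      rfl
    · refine Or.inl fun a ha => ?_
      obtain ⟨b, -, rfl⟩ := List.mem_map.1 ha
      exact hx

lemma IsPureAt.succ (hφ : ∀ n a x, a.1 = 0 → φ n a x = x) {N n : ℕ} {u : List LetterCode}
    (hu : IsPureAt φ N n u) : IsPureAt φ (N + 1) n u := by
  induction N generalizing n u with
  | zero => exact fun x => IsPure.sectionStep hφ n hu x
  | succ N ih => exact fun x => ih (hu x)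

lemma IsPureAt.append (hφ : ∀ n a x, a.1 = 0 → φ n a x = x) {N n : ℕ} {u u' : List LetterCode}
    (hu : IsPureAt φ N n u) (hu' : IsPureAt φ N n u') : IsPureAt φ (N + 1) n (u ++ u') := by
  induction N generalizing n u u' with
  | zero =>
    intro x
    rw [sectionStep_append]
    rcases hu with h | h
    · rw [sectionStep_of_rooted n h, List.nil_append]
      exact IsPure.sectionStep hφ n hu' x
    · rcases hu' with h' | h'
      · rw [sectionStep_of_rooted n h', List.append_nil]
        exact IsPure.sectionStep hφ n (Or.inr h) _
      · have := IsPure.sectionStep hφ n (u := u ++ u') (Or.inr fun a ha =>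
          (List.mem_append.1 ha).elim (h a) (h' a)) x
        rwa [sectionStep_append] at this
  | succ N ih =>
    intro x
    rw [sectionStep_append]
    exact ih (hu _) (hu' x)

/-- Every word contracts: each letter is pure, and a product of two pure words becomes pure after
one step of the wreath recursion. -/
lemma exists_isPureAt (hφ : ∀ n a x, a.1 = 0 → φ n a x = x) (n : ℕ) (u : List LetterCode) :
    ∃ N, IsPureAt φ N n u := by
  induction u with
  | nil => exact ⟨0, Or.inl fun a ha => absurd ha List.not_mem_nil⟩
  | cons a u ih =>
    obtain ⟨N, hN⟩ := ih
    refine ⟨N + 1, IsPureAt.append hφ (u := [a]) ?_ hN⟩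
    clear hN
    induction N with
    | zero =>
      by_cases ha : a.1 = 0
      · exact Or.inr fun b hb => by rwa [List.mem_singleton.1 hb]
      · exact Or.inl fun b hb => by rwa [List.mem_singleton.1 hb]
    | succ N ih => exact IsPureAt.succ hφ ih

lemma sectionRun_cons (st : ℕ × List LetterCode × List ℕ) (x : ℕ) (v : List ℕ) :
    sectionRun φ st (x :: v) = sectionRun φ (st.1 + 1, (sectionStep φ st.1 st.2.1 x).2,
      st.2.2 ++ [(sectionStep φ st.1 st.2.1 x).1]) v := rfl

lemma sectionRun_length (st : ℕ × List LetterCode × List ℕ) (v : List ℕ) :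
    (sectionRun φ st v).2.2.length = st.2.2.length + v.length := by
  induction v generalizing st with
  | nil => rfl
  | cons x v ih =>
    rw [sectionRun_cons, ih, List.length_cons, List.length_append, List.length_singleton,
      Nat.add_assoc, Nat.add_comm 1]

lemma IsPureAt.isPure_sectionRun {N : ℕ} {st : ℕ × List LetterCode × List ℕ}
    (h : IsPureAt φ N st.1 st.2.1) {v : List ℕ} (hv : v.length = N) :
    IsPure (sectionRun φ st v).2.1 := by
  induction v generalizing st N with
  | nil => subst hv; exact h
  | cons x v ih =>
    subst hv
    rw [sectionRun_cons]
    exact ih (h x) rfl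

end Contraction

namespace ActionData

variable {H : Type*} [Group H] (D : ActionData H) (t : ℕ → H)

/-- The permutation represented by a code at level `n`. -/
def codeVal (n : ℕ) (a : LetterCode) : Perm (List ℕ) :=
  D.letter n a.1 (cond a.2.2 (t a.2.1) (t a.2.1)⁻¹)

/-- The permutation represented by a word in codes at level `n`. -/
def codesVal (n : ℕ) (u : List LetterCode) : Perm (List ℕ) := (u.map (D.codeVal t n)).prod

lemma codesVal_mem (n : ℕ) (u : List LetterCode) : D.codesVal t n u ∈ D.grp n :=
  Subgroup.list_prod_mem _ fun x hx => by
    obtain ⟨a, -, rfl⟩ := List.mem_map.1 hx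
    exact D.letter_mem _ _ _

/-- The map `φ` describes how the letters move the first letter of a word. -/
def Describes (φ : ℕ → LetterCode → ℕ → ℕ) : Prop :=
  ∀ n a x, φ n a x = if a.1 = 0 then x else
    D.act n a.1 (cond a.2.2 (t a.2.1) (t a.2.1)⁻¹) x

variable {D t} {φ : ℕ → LetterCode → ℕ → ℕ}

lemma Describes.of_eq_zero (hφ : D.Describes t φ) (n : ℕ) (a : LetterCode) (x : ℕ)
    (ha : a.1 = 0) : φ n a x = x := by rw [hφ, if_pos ha]

lemma Describes.codesVal_cons (hφ : D.Describes t φ) (n : ℕ) (u : List LetterCode) (x : ℕ)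
    (w : List ℕ) : D.codesVal t n u (x :: w) =
      (sectionStep φ n u x).1 :: D.codesVal t (n + 1) (sectionStep φ n u x).2 w := by
  induction u with
  | nil => rfl
  | cons a u ih =>
    have h1 : ∀ n (a : LetterCode) u, D.codesVal t n (a :: u) =
        D.codeVal t n a * D.codesVal t n u := fun _ _ _ => by
      rw [codesVal, List.map_cons, List.prod_cons, ← codesVal]
    have h2 : sectionStep φ n (a :: u) x = (φ n a (sectionStep φ n u x).1, (if a.1 = 0 then
      [((sectionStep φ n u x).1, a.2)] else []) ++ (sectionStep φ n u x).2) := rfl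
    rw [h1, Perm.mul_apply, ih, h2]
    by_cases ha : a.1 = 0
    · rw [codeVal, ha, letter_zero, levelOne_cons, hφ.of_eq_zero _ _ _ ha, if_pos rfl,
        List.singleton_append, h1, Perm.mul_apply]
      rfl
    · rw [codeVal, letter_of_ne D ha, rooted_cons, hφ, if_neg ha, if_neg ha, List.nil_append]

lemma Describes.codesVal_append (hφ : D.Describes t φ) (st : ℕ × List LetterCode × List ℕ)
    (v w : List ℕ) : st.2.2 ++ D.codesVal t st.1 st.2.1 (v ++ w) =
      (sectionRun φ st v).2.2 ++
        D.codesVal t (st.1 + v.length) (sectionRun φ st v).2.1 w := by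
  induction v generalizing st with
  | nil => rfl
  | cons x v ih =>
    have := ih (st.1 + 1, (sectionStep φ st.1 st.2.1 x).2,
      st.2.2 ++ [(sectionStep φ st.1 st.2.1 x).1])
    rw [List.cons_append, hφ.codesVal_cons, List.append_cons, sectionRun_cons, List.length_cons,
      Nat.add_comm v.length, ← Nat.add_assoc]
    exact this

lemma Describes.codesVal_zero_append (hφ : D.Describes t φ) (u : List LetterCode)
    (v w : List ℕ) : D.codesVal t 0 u (v ++ w) = (sectionRun φ (0, u, []) v).2.2 ++
        D.codesVal t v.length (sectionRun φ (0, u, []) v).2.1 w := by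
  have := hφ.codesVal_append (0, u, []) v w
  rwa [List.nil_append, zero_add] at this

lemma Describes.codesVal_zero (hφ : D.Describes t φ) (u : List LetterCode)
    (v : List ℕ) : D.codesVal t 0 u v = (sectionRun φ (0, u, []) v).2.2 := by
  have := hφ.codesVal_zero_append u v []
  rwa [List.append_nil, D.apply_nil (D.codesVal_mem t _ _), List.append_nil] at this

lemma codesVal_of_directed (n : ℕ) {u : List LetterCode} (hu : ∀ a ∈ u, a.1 = 0) :
    D.codesVal t n u = D.letter n 0 (genVal t (u.map Prod.snd)) := by
  induction u with
  | nil => rw [List.map_nil, genVal, List.map_nil, List.prod_nil, map_one]; rfl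
  | cons a u ih =>
    rw [codesVal, List.map_cons, List.prod_cons, ← codesVal,
      ih fun b hb => hu b (List.mem_cons_of_mem _ hb), codeVal, hu a List.mem_cons_self,
      List.map_cons, genVal, genVal, List.map_cons, List.prod_cons, map_mul]

lemma codesVal_of_rooted (n : ℕ) {u : List LetterCode} (hu : ∀ a ∈ u, a.1 ≠ 0) :
    ∃ σ, D.codesVal t n u = rooted σ := by
  induction u with
  | nil => exact ⟨1, (map_one _).symm⟩
  | cons a u ih =>
    obtain ⟨σ, hσ⟩ := ih fun b hb => hu b (List.mem_cons_of_mem _ hb)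
    refine ⟨D.act n a.1 (cond a.2.2 (t a.2.1) (t a.2.1)⁻¹) * σ, ?_⟩
    rw [map_mul, ← hσ, ← letter_of_ne D (hu a List.mem_cons_self)]
    rw [codesVal, List.map_cons, List.prod_cons, ← codesVal]
    rfl

/-- A word represents the trivial element if and only if, for some level `l`, it acts trivially on
the words of length `l + 1`, and each of its sections at words of length `l` is a product of
rooted letters, or a product of directed letters whose underlying element of `H` is trivial. -/
lemma Describes.codesVal_eq_one_iff (hφ : D.Describes t φ) (u : List LetterCode) :
    D.codesVal t 0 u = 1 ↔ ∃ l,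
      (∀ v ∈ levelWords D.m (l + 1), (sectionRun φ (0, u, []) v).2.2 = v) ∧
      ∀ v ∈ levelWords D.m l, (∀ a ∈ (sectionRun φ (0, u, []) v).2.1, a.1 ≠ 0) ∨
        ((∀ a ∈ (sectionRun φ (0, u, []) v).2.1, a.1 = 0) ∧
          genVal t ((sectionRun φ (0, u, []) v).2.1.map Prod.snd) = 1) := by
  constructor
  · intro h
    obtain ⟨l, hl⟩ := exists_isPureAt hφ.of_eq_zero 0 u
    refine ⟨l, fun v _ => by rw [← hφ.codesVal_zero, h]; rfl, fun v hv => ?_⟩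
    rw [mem_levelWords] at hv
    refine (hl.isPure_sectionRun (st := (0, u, [])) hv.2).imp_right fun h0 => ⟨h0, ?_⟩
    apply D.letter_zero_injective v.length
    rw [← codesVal_of_directed _ h0, map_one]
    ext1 w
    have := hφ.codesVal_zero_append u v w
    rw [h] at this
    exact (List.append_inj_right this (by rw [sectionRun_length]; simp)).symm
  · rintro ⟨l, h1, h2⟩
    have key : ∀ v ∈ levelWords D.m l, ∀ w, IsWord D.m 0 (v ++ w) → w ≠ [] →
        D.codesVal t 0 u (v ++ w) = v ++ w := by
      intro v hv w hw hw0
      obtain ⟨x, w, rfl⟩ := List.exists_cons_of_ne_nil hw0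
      have hvl := (mem_levelWords.1 hv).2
      have hvx : v ++ [x] ∈ levelWords D.m (l + 1) := by
        rw [mem_levelWords]
        rw [List.append_cons, isWord_append] at hw
        exact ⟨hw.1, by simp [hvl]⟩
      have h3 := h1 _ hvx
      rw [← hφ.codesVal_zero, hφ.codesVal_zero_append] at h3
      have h4 : (sectionRun φ (0, u, []) v).2.2.length = v.length := by
        rw [sectionRun_length]; simp
      have h5 := List.append_inj_right h3 h4
      rw [hφ.codesVal_zero_append, List.append_inj_left h3 h4]
      congr 1
      rcases h2 v hv with h | ⟨h, h'⟩
      · obtain ⟨σ, hσ⟩ := codesVal_of_rooted (D := D) (t := t) v.length h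
        rw [hσ, rooted_cons] at h5 ⊢
        rw [(List.cons.inj h5).1]
      · rw [codesVal_of_directed _ h, h', map_one]
        rfl
    refine D.eq_one_of_forall_isWord (D.codesVal_mem t 0 u) fun w hw => ?_
    -- a short word is a prefix of a long one
    have hz : IsWord D.m 0 (w ++ List.replicate (l + 1) 0) :=
      isWord_append.2 ⟨hw, isWord_replicate_zero D.m_pos _ _⟩
    have h3 : D.codesVal t 0 u (w ++ List.replicate (l + 1) 0) = w ++ List.replicate (l + 1) 0 := by
      have h4 := key ((w ++ List.replicate (l + 1) 0).take l) ?_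
        ((w ++ List.replicate (l + 1) 0).drop l) ?_ ?_
      · rwa [List.take_append_drop] at h4
      · rw [mem_levelWords]
        refine ⟨?_, by simp; omega⟩
        rw [← List.take_append_drop l (w ++ List.replicate (l + 1) 0), isWord_append] at hz
        exact hz.1
      · rwa [List.take_append_drop]
      · intro h
        have := congrArg List.length h
        simp at this
        omega
    have h5 := D.apply_take (D.codesVal_mem t 0 u) (w ++ List.replicate (l + 1) 0) w.length
    rw [h3, List.take_left] at h5
    exact h5.symm

end ActionData

namespace ActionData

variable {H : Type*} [Group H] (D : ActionData H) (t : ℕ → H)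

/-! ### The word problem and the finite quotients of the branch group -/

/-- A finite family of rooted and directed permutations, described by codes without signs. -/
def codeGen {K : ℕ} (τ : Fin K → ℕ × ℕ) (e : Fin K) : D.grp 0 :=
  ⟨D.letter 0 (τ e).1 (t (τ e).2), D.letter_mem _ _ _⟩

/-- The word in codes that corresponds to a word in the generators. -/
def _root_.toCodes {K : ℕ} (τ : Fin K → ℕ × ℕ) (w : SymWord K) : List LetterCode :=
  w.map fun p => ((τ p.1).1, (τ p.1).2, p.2)

lemma _root_.primrec_toCodes {K : ℕ} (τ : Fin K → ℕ × ℕ) : Primrec (toCodes τ) := by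
  have h : Primrec fun p : SymWord K × (Fin K × Bool) => τ p.2.1 :=
    (Primrec.dom_finite τ).comp (Primrec.fst.comp Primrec.snd)
  exact Primrec.list_map Primrec.id
    ((Primrec.fst.comp h).pair ((Primrec.snd.comp h).pair (Primrec.snd.comp Primrec.snd)))

lemma coe_wordEval_codeGen {K : ℕ} (τ : Fin K → ℕ × ℕ) (w : SymWord K) :
    ((wordEval (D.codeGen t τ) w : D.grp 0) : Perm (List ℕ)) = D.codesVal t 0 (toCodes τ w) := by
  induction w with
  | nil => rfl
  | cons p w ih =>
    have h1 : wordEval (D.codeGen t τ) (p :: w) =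
        cond p.2 (D.codeGen t τ p.1) (D.codeGen t τ p.1)⁻¹ * wordEval (D.codeGen t τ) w := by
      rw [wordEval, List.map_cons, List.prod_cons, ← wordEval]
    have h2 : D.codesVal t 0 (toCodes τ (p :: w)) =
        D.codeVal t 0 ((τ p.1).1, (τ p.1).2, p.2) * D.codesVal t 0 (toCodes τ w) := by
      rw [toCodes, List.map_cons, codesVal, List.map_cons, List.prod_cons]; rfl
    rw [h1, h2, Subgroup.coe_mul, ih]
    congr 1
    rcases p with ⟨i, _ | _⟩
    · simp [codeVal, codeGen]
    · rfl

lemma wordEval_codeGen_eq_one_iff {K : ℕ} (τ : Fin K → ℕ × ℕ) (w : SymWord K) :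
    wordEval (D.codeGen t τ) w = 1 ↔ D.codesVal t 0 (toCodes τ w) = 1 := by
  rw [← coe_wordEval_codeGen, OneMemClass.coe_eq_one]

variable {D t} {φ : ℕ → LetterCode → ℕ → ℕ}

/-- If the word problem of `H` is recursively enumerable and the actions are primitive recursive,
then the word problem of the group generated by the letters is recursively enumerable. -/
lemma Describes.rePred (hφ : D.Describes t φ)
    (hφp : Primrec fun p : ℕ × LetterCode × ℕ => φ p.1 p.2.1 p.2.2) (hm : Primrec D.m)
    (hH : REPred fun w => genVal t w = 1) {K : ℕ} (τ : Fin K → ℕ × ℕ) :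
    REPred fun w : SymWord K => wordEval (D.codeGen t τ) w = 1 := by
  obtain ⟨q, hq, hmono, hHq⟩ := hH.exists_stage
  have hrun := primrec_sectionRun hφp
  have h1 : PrimrecRel fun (v : List ℕ) (u : List LetterCode) =>
      (sectionRun φ (0, u, []) v).2.2 = v :=
    Primrec.eq.comp (Primrec.snd.comp (Primrec.snd.comp (hrun.comp Primrec.snd Primrec.fst)))
      Primrec.fst
  have hz : PrimrecPred fun a : LetterCode => a.1 = 0 :=
    Primrec.eq.comp Primrec.fst (Primrec.const 0)
  have h2 : PrimrecRel fun (v : List ℕ) (p : List LetterCode × ℕ) =>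
      (∀ a ∈ (sectionRun φ (0, p.1, []) v).2.1, a.1 ≠ 0) ∨
        ((∀ a ∈ (sectionRun φ (0, p.1, []) v).2.1, a.1 = 0) ∧
          q ((sectionRun φ (0, p.1, []) v).2.1.map Prod.snd) p.2) := by
    have hsec : Primrec fun x : List ℕ × (List LetterCode × ℕ) =>
        (sectionRun φ (0, x.2.1, []) x.1).2.1 :=
      Primrec.fst.comp (Primrec.snd.comp (hrun.comp (Primrec.fst.comp Primrec.snd) Primrec.fst))
    refine PrimrecPred.or (hz.not.forall_mem_list.comp hsec)
      (PrimrecPred.and (hz.forall_mem_list.comp hsec) (hq.comp ?_ (Primrec.snd.comp Primrec.snd)))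
    exact Primrec.list_map hsec (Primrec.snd.comp Primrec.snd)
  have h3 : PrimrecRel fun (w : SymWord K) (p : ℕ × ℕ) =>
      (∀ v ∈ levelWords D.m (p.1 + 1), (sectionRun φ (0, toCodes τ w, []) v).2.2 = v) ∧
      ∀ v ∈ levelWords D.m p.1, (∀ a ∈ (sectionRun φ (0, toCodes τ w, []) v).2.1, a.1 ≠ 0) ∨
        ((∀ a ∈ (sectionRun φ (0, toCodes τ w, []) v).2.1, a.1 = 0) ∧
          q ((sectionRun φ (0, toCodes τ w, []) v).2.1.map Prod.snd) p.2) := by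
    have hw : Primrec fun x : SymWord K × (ℕ × ℕ) => toCodes τ x.1 :=
      (primrec_toCodes τ).comp Primrec.fst
    have hl : Primrec fun x : SymWord K × (ℕ × ℕ) => x.2.1 := Primrec.fst.comp Primrec.snd
    refine PrimrecPred.and ?_ ?_
    · exact h1.forall_mem_list.comp ((primrec_levelWords hm).comp (Primrec.succ.comp hl)) hw
    · exact h2.forall_mem_list.comp ((primrec_levelWords hm).comp hl)
        (hw.pair (Primrec.snd.comp Primrec.snd))
  refine h3.rePred_exists.of_eq fun w => ?_
  rw [wordEval_codeGen_eq_one_iff, hφ.codesVal_eq_one_iff]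
  constructor
  · rintro ⟨⟨l, s⟩, ha, hb⟩
    exact ⟨l, ha, fun v hv => (hb v hv).imp_right fun h => ⟨h.1, (hHq _).2 ⟨s, h.2⟩⟩⟩
  · rintro ⟨l, ha, hb⟩
    -- a common stage for the finitely many words of length `l`
    have hs : ∀ L : List (List ℕ), (∀ v ∈ L, v ∈ levelWords D.m l) → ∃ s, ∀ v ∈ L,
        (∀ a ∈ (sectionRun φ (0, toCodes τ w, []) v).2.1, a.1 ≠ 0) ∨
        ((∀ a ∈ (sectionRun φ (0, toCodes τ w, []) v).2.1, a.1 = 0) ∧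
          q ((sectionRun φ (0, toCodes τ w, []) v).2.1.map Prod.snd) s) := by
      intro L
      induction L with
      | nil => exact fun _ => ⟨0, fun v hv => absurd hv List.not_mem_nil⟩
      | cons v L ih =>
        intro hL
        obtain ⟨s, hs⟩ := ih fun v hv => hL v (List.mem_cons_of_mem _ hv)
        rcases hb v (hL v List.mem_cons_self) with h | ⟨h, h'⟩
        · refine ⟨s, fun v' hv' => ?_⟩
          rcases List.mem_cons.1 hv' with rfl | hv'
          exacts [Or.inl h, hs v' hv']
        · obtain ⟨s', hs'⟩ := (hHq _).1 h'
          refine ⟨max s s', fun v' hv' => ?_⟩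
          rcases List.mem_cons.1 hv' with rfl | hv'
          · exact Or.inr ⟨h, hmono _ _ _ (le_max_right s s') hs'⟩
          · exact (hs v' hv').imp_right fun h => ⟨h.1, hmono _ _ _ (le_max_left s s') h.2⟩
    obtain ⟨s, hs⟩ := hs _ fun v hv => hv
    exact ⟨(l, s), ha, hs⟩

/-- The position of a word in a list, where words are compared by the decidable equality of lists
that is used for permuting the entries of lists without duplicates. -/
def _root_.listIndex (L : List (List ℕ)) (v : List ℕ) : ℕ :=
  @List.idxOf (List ℕ) instBEqOfDecidableEq v L

lemma _root_.primrec_listIndex : Primrec₂ listIndex :=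
  Primrec.list_idxOf.comp Primrec.snd Primrec.fst

/-- The words of length `l`, numbered by their position in `levelWords`. -/
noncomputable def levelEquiv (D : ActionData H) (l : ℕ) :
    {w // IsWord D.m 0 w ∧ w.length = l} ≃ Fin (levelWords D.m l).length :=
  (Equiv.subtypeEquivRight fun _ => mem_levelWords.symm).trans
    ((nodup_levelWords D.m l).getEquiv _).symm

/-- The action on the words of length `l`, as a homomorphism to a permutation group of
a finite ordinal. -/
noncomputable def levelHom (D : ActionData H) (l : ℕ) :
    D.grp 0 →* Perm (Fin (levelWords D.m l).length) :=
  (D.levelEquiv l).permCongrHom.toMonoidHom.comp (D.levelAction 0 l)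

lemma levelHom_apply (l : ℕ) (g : D.grp 0) (k : Fin (levelWords D.m l).length) :
    (D.levelHom l g k : ℕ) = listIndex (levelWords D.m l) (g.1 (levelWords D.m l)[k]) := by
  simp [levelHom, levelEquiv, levelAction_apply, listIndex]

lemma levelHom_ne_one {l : ℕ} {g : D.grp 0} {v : List ℕ} (hv : v ∈ levelWords D.m l)
    (h : g.1 v ≠ v) : D.levelHom l g ≠ 1 := by
  intro h1
  have h2 : D.levelAction 0 l g = 1 :=
    (D.levelEquiv l).permCongrHom.injective (h1.trans (map_one _).symm)
  apply h
  rw [← D.levelAction_apply 0 l g ⟨v, mem_levelWords.1 hv⟩, h2]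
  rfl

lemma Describes.homCode_levelHom (hφ : D.Describes t φ) {K : ℕ} (τ : Fin K → ℕ × ℕ) (l : ℕ) :
    homCode (D.codeGen t τ) (D.levelHom l) = ((levelWords D.m l).length, List.ofFn fun e : Fin K =>
      (levelWords D.m l).map fun v => listIndex (levelWords D.m l)
        (sectionRun φ (0, toCodes τ [(e, true)], []) v).2.2) := by
  rw [homCode]
  congr 2
  funext e
  apply List.ext_getElem
  · simp
  · intro i h1 h2
    rw [List.getElem_ofFn, levelHom_apply, List.getElem_map,
      ← hφ.codesVal_zero, ← coe_wordEval_codeGen]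
    simp [wordEval]

/-- If the actions are primitive recursive, then nontrivial elements are detected in the actions
on the finite levels of the tree. -/
lemma Describes.isEFRFPlus (hφ : D.Describes t φ)
    (hφp : Primrec fun p : ℕ × LetterCode × ℕ => φ p.1 p.2.1 p.2.2) (hm : Primrec D.m)
    {K : ℕ} (τ : Fin K → ℕ × ℕ) (hτ : Subgroup.closure (Set.range (D.codeGen t τ)) = ⊤) :
    IsEFRFPlus (D.grp 0) := by
  classical
  have hrun := primrec_sectionRun hφp
  have h1 : PrimrecRel fun (w : SymWord K) (l : ℕ) =>
      ∃ v ∈ levelWords D.m l, (sectionRun φ (0, toCodes τ w, []) v).2.2 ≠ v := by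
    have h : PrimrecRel fun (v : List ℕ) (u : List LetterCode) =>
        (sectionRun φ (0, u, []) v).2.2 ≠ v :=
      PrimrecPred.not (Primrec.eq.comp (Primrec.snd.comp (Primrec.snd.comp
        (hrun.comp Primrec.snd Primrec.fst))) Primrec.fst)
    exact h.exists_mem_list.comp ((primrec_levelWords hm).comp Primrec.snd)
      ((primrec_toCodes τ).comp Primrec.fst)
  set code : ℕ → ℕ × List (List ℕ) := fun l => ((levelWords D.m l).length,
    List.ofFn fun e : Fin K => (levelWords D.m l).map fun v => listIndex (levelWords D.m l)
      (sectionRun φ (0, toCodes τ [(e, true)], []) v).2.2) with hcode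
  have h2 : Primrec code := by
    have hL := primrec_levelWords hm
    refine (Primrec.list_length.comp hL).pair (Primrec.list_ofFn fun e => ?_)
    refine Primrec.list_map hL ?_
    exact primrec_listIndex.comp (hL.comp Primrec.fst) (Primrec.snd.comp (Primrec.snd.comp
      (hrun.comp (Primrec.const (toCodes τ [(e, true)])) Primrec.snd)))
  -- the search for a level on which a word acts nontrivially
  let search : SymWord K → ℕ →. Bool := fun w l => Part.some (decide
    (∃ v ∈ levelWords D.m l, (sectionRun φ (0, toCodes τ w, []) v).2.2 ≠ v))
  refine ⟨K, D.codeGen t τ, hτ, fun w => (Nat.rfind (search w)).map code, ?_, ?_⟩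
  · refine Partrec.map (Partrec.rfind ?_) (h2.comp Primrec.snd).to_comp
    exact h1.decide.to_comp.partrec₂
  · intro w
    have key : ∀ v, (wordEval (D.codeGen t τ) w).1 v =
        (sectionRun φ (0, toCodes τ w, []) v).2.2 := fun v => by
      rw [coe_wordEval_codeGen, hφ.codesVal_zero]
    constructor
    · intro hw
      obtain ⟨v, hv, hne⟩ : ∃ v, IsWord D.m 0 v ∧
          (sectionRun φ (0, toCodes τ w, []) v).2.2 ≠ v := by
        by_contra hcon
        push Not at hcon
        refine hw (Subtype.ext (D.eq_one_of_forall_isWord (Subtype.property _) fun v hv => ?_))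
        rw [key, hcon v hv]
      have hdom : (Nat.rfind (search w)).Dom := by
        refine Nat.rfind_dom.2 ⟨v.length, ?_, fun _ => trivial⟩
        rw [Part.mem_some_iff, eq_comm, decide_eq_true_iff]
        exact ⟨v, mem_levelWords.2 ⟨hv, rfl⟩, hne⟩
      obtain ⟨l, hl⟩ := Part.dom_iff_mem.1 hdom
      have hspec := Nat.rfind_spec hl
      rw [Part.mem_some_iff, eq_comm, decide_eq_true_iff] at hspec
      obtain ⟨v', hv', hne'⟩ := hspec
      refine ⟨_, D.levelHom l, levelHom_ne_one hv' (by rwa [key]), ?_⟩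
      rw [hφ.homCode_levelHom]
      exact Part.mem_map code hl
    · intro hw hdom
      obtain ⟨l, hl, -⟩ := Nat.rfind_dom.1 (show (Nat.rfind (search w)).Dom from hdom)
      rw [Part.mem_some_iff, eq_comm, decide_eq_true_iff] at hl
      obtain ⟨v, -, hne⟩ := hl
      rw [← key, hw] at hne
      exact hne rfl

end ActionData

/-! ### Computability for the product with the rotation group -/

section

variable {G : Type*} [Group G] {N : ℕ} (s : Fin N → G)

/-- The word over the generators of `G` that underlies a word over the generators of
`G × RotGroup`. -/
def restrictWord (N : ℕ) (w : List (ℕ × Bool)) : SymWord N :=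
  w.filterMap fun p => ((List.finRange N)[p.1]?).map fun i => (i, p.2)

/-- The exponent, up to multiples of 3, of the `k`-th rotation in a word over the generators of
`G × RotGroup`. -/
def rotExponent (N k : ℕ) (w : List (ℕ × Bool)) : ℕ :=
  w.foldr (fun p c => (if p.1 = N + k then cond p.2 1 2 else 0) + c) 0

lemma primrec_restrictWord : Primrec (restrictWord N) := by
  refine Primrec.listFilterMap Primrec.id ?_
  refine Primrec.option_map (f := fun p : List (ℕ × Bool) × (ℕ × Bool) =>
    (List.finRange N)[p.2.1]?) ?_ ?_
  · exact (Primrec.list_getElem?₁ (List.finRange N)).comp (Primrec.fst.comp Primrec.snd)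
  · exact Primrec.snd.pair (Primrec.snd.comp (Primrec.snd.comp Primrec.fst))

lemma primrec_rotExponent (k : ℕ) : Primrec (rotExponent N k) := by
  refine Primrec.list_foldr (f := fun w : List (ℕ × Bool) => w) (g := fun _ => 0)
    (h := fun _ p => (if p.1.1 = N + k then cond p.1.2 1 2 else 0) + p.2) Primrec.id
    (Primrec.const 0) ?_
  have hp : Primrec fun p : List (ℕ × Bool) × (ℕ × Bool) × ℕ => p.2.1 :=
    Primrec.fst.comp Primrec.snd
  exact Primrec.nat_add.comp (Primrec.ite
    (Primrec.eq.comp (Primrec.fst.comp hp) (Primrec.const (N + k)))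
    (Primrec.cond (Primrec.snd.comp hp) (Primrec.const 1) (Primrec.const 2)) (Primrec.const 0))
    (Primrec.snd.comp Primrec.snd)

lemma genVal_cons {H : Type*} [Group H] (t : ℕ → H) (p : ℕ × Bool) (w : List (ℕ × Bool)) :
    genVal t (p :: w) = cond p.2 (t p.1) (t p.1)⁻¹ * genVal t w := by
  rw [genVal, List.map_cons, List.prod_cons, ← genVal]

lemma genVal_rotGen_fst (w : List (ℕ × Bool)) :
    (genVal (rotGen s) w).1 = wordEval s (restrictWord N w) := by
  induction w with
  | nil => rfl
  | cons p w ih =>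
    rw [genVal_cons, Prod.fst_mul, ih]
    by_cases h : p.1 < N
    · have h1 : restrictWord N (p :: w) = (⟨p.1, h⟩, p.2) :: restrictWord N w := by
        rw [restrictWord, List.filterMap_cons]
        simp [h, restrictWord]
      rw [h1, wordEval, wordEval, List.map_cons, List.prod_cons, rotGen, dif_pos h]
      rcases p.2 with _ | _ <;> rfl
    · have h1 : restrictWord N (p :: w) = restrictWord N w := by
        rw [restrictWord, List.filterMap_cons]
        simp [h, restrictWord]
      rw [h1, rotGen, dif_neg h]
      rcases p.2 with _ | _ <;> simp

lemma genVal_rotGen_snd (w : List (ℕ × Bool)) (k : Fin 3) :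
    (genVal (rotGen s) w).2 k = Multiplicative.ofAdd (rotExponent N k w : ZMod 3) := by
  induction w with
  | nil => rfl
  | cons p w ih =>
    have h2 : rotExponent N k (p :: w) =
        (if p.1 = N + k then cond p.2 1 2 else 0) + rotExponent N k w := rfl
    rw [genVal_cons, Prod.snd_mul, Pi.mul_apply, ih, h2, Nat.cast_add, ofAdd_add]
    congr 1
    by_cases h : p.1 = N + k
    · rw [rotGen, dif_neg (by omega), if_pos h]
      rcases p.2 with _ | _
      · simp only [cond_false, Prod.snd_inv, Pi.inv_apply, if_pos h]; rfl
      · simp only [cond_true, if_pos h, Nat.cast_one]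
    · rw [if_neg h]
      by_cases h' : p.1 < N
      · rw [rotGen, dif_pos h']
        rcases p.2 with _ | _ <;> simp
      · rw [rotGen, dif_neg h']
        rcases p.2 with _ | _ <;> simp [h]

lemma genVal_rotGen_eq_one_iff (w : List (ℕ × Bool)) :
    genVal (rotGen s) w = 1 ↔ wordEval s (restrictWord N w) = 1 ∧
      (rotExponent N 0 w % 3 = 0 ∧ rotExponent N 1 w % 3 = 0 ∧ rotExponent N 2 w % 3 = 0) := by
  have h1 : ∀ k : Fin 3, (genVal (rotGen s) w).2 k = 1 ↔ rotExponent N k w % 3 = 0 := fun k => by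
    rw [genVal_rotGen_snd, ofAdd_eq_one, ZMod.natCast_eq_zero_iff, Nat.dvd_iff_mod_eq_zero]
  rw [Prod.ext_iff, genVal_rotGen_fst, Prod.fst_one, Prod.snd_one, funext_iff, Fin.forall_fin_succ,
    Fin.forall_fin_two]
  simp only [Pi.one_apply, h1]
  rfl

lemma rePred_genVal_rotGen (h : REPred fun w : SymWord N => wordEval s w = 1) :
    REPred fun w => genVal (rotGen s) w = 1 := by
  obtain ⟨q, hq, -, h⟩ := h.exists_stage
  have h0 : ∀ k, PrimrecPred fun w => rotExponent N k w % 3 = 0 := fun k =>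
    Primrec.eq.comp (Primrec.nat_mod.comp (primrec_rotExponent k) (Primrec.const 3))
      (Primrec.const 0)
  have h1 : PrimrecRel fun (w : List (ℕ × Bool)) (n : ℕ) => q (restrictWord N w) n ∧
      (rotExponent N 0 w % 3 = 0 ∧ rotExponent N 1 w % 3 = 0 ∧ rotExponent N 2 w % 3 = 0) :=
    PrimrecPred.and (hq.comp (primrec_restrictWord.comp Primrec.fst) Primrec.snd)
      (((h0 0).and ((h0 1).and (h0 2))).comp Primrec.fst)
  refine h1.rePred_exists.of_eq fun w => ?_
  rw [genVal_rotGen_eq_one_iff, h, exists_and_right]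

variable (d : ℕ → ℕ) (f : ∀ n, G →* Perm (Fin (d n))) (N)

/-- The action of the letters of level `n` on the alphabet, computed from a table `A` for the
actions of the generators of `G`. -/
def rotTable (A : ℕ → ℕ × Bool → ℕ → ℕ) (n : ℕ) (a : LetterCode) (x : ℕ) : ℕ :=
  if a.1 = 1 then if a.2.1 < N ∧ x / 2 < d n then 2 * A n a.2 (x / 2) + x % 2 else x
  else if a.1 = 2 ∧ a.2.1 = N then blockRotFun 0 1 (cond a.2.2 1 2) x
  else if a.1 = 3 ∧ a.2.1 = N + 1 then blockRotFun 2 (d n + 3) (cond a.2.2 1 2) x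
  else if a.1 = 4 ∧ a.2.1 = N + 2 then blockRotFun 3 (d n + 3) (cond a.2.2 1 2) x
  else x

lemma primrec_blockRotFun {α : Type*} [Primcodable α] {o q e x : α → ℕ} (ho : Primrec o)
    (hq : Primrec q) (he : Primrec e) (hx : Primrec x) :
    Primrec fun a => blockRotFun (o a) (q a) (e a) (x a) := by
  have h3 := Primrec.const (α := α) 3
  have hxo := Primrec.nat_sub.comp hx ho
  refine Primrec.ite (PrimrecPred.and (Primrec.nat_le.comp ho hx) (Primrec.nat_lt.comp hx
    (Primrec.nat_add.comp ho (Primrec.nat_mul.comp h3 hq)))) ?_ hx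
  exact Primrec.nat_add.comp (Primrec.nat_add.comp ho (Primrec.nat_mul.comp h3
    (Primrec.nat_div.comp hxo h3)))
    (Primrec.nat_mod.comp (Primrec.nat_add.comp (Primrec.nat_mod.comp hxo h3) he) h3)

lemma primrec_rotTable {A : ℕ → ℕ × Bool → ℕ → ℕ} (hd : Primrec d)
    (hA : Primrec fun p : ℕ × (ℕ × Bool) × ℕ => A p.1 p.2.1 p.2.2) :
    Primrec fun p : ℕ × LetterCode × ℕ => rotTable N d A p.1 p.2.1 p.2.2 := by
  have hx : Primrec fun p : ℕ × LetterCode × ℕ => p.2.2 := Primrec.snd.comp Primrec.snd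
  have ha : Primrec fun p : ℕ × LetterCode × ℕ => p.2.1 := Primrec.fst.comp Primrec.snd
  have hj := Primrec.fst.comp ha
  have ha2 := Primrec.snd.comp ha
  have hi := Primrec.fst.comp ha2
  have he : Primrec fun p : ℕ × LetterCode × ℕ => cond p.2.1.2.2 1 2 :=
    Primrec.cond (Primrec.snd.comp ha2) (Primrec.const 1) (Primrec.const 2)
  have hdn : Primrec fun p : ℕ × LetterCode × ℕ => d p.1 := hd.comp Primrec.fst
  have hd3 := Primrec.nat_add.comp hdn (Primrec.const 3)
  have hx2 := Primrec.nat_div.comp hx (Primrec.const 2)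
  refine Primrec.ite (Primrec.eq.comp hj (Primrec.const 1)) ?_ ?_
  · refine Primrec.ite (PrimrecPred.and (Primrec.nat_lt.comp hi (Primrec.const N))
      (Primrec.nat_lt.comp hx2 hdn)) ?_ hx
    exact Primrec.nat_add.comp (Primrec.nat_mul.comp (Primrec.const 2)
      (hA.comp (Primrec.fst.pair (ha2.pair hx2)))) (Primrec.nat_mod.comp hx (Primrec.const 2))
  · refine Primrec.ite (PrimrecPred.and (Primrec.eq.comp hj (Primrec.const 2))
      (Primrec.eq.comp hi (Primrec.const N)))
      (primrec_blockRotFun (Primrec.const 0) (Primrec.const 1) he hx) ?_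
    refine Primrec.ite (PrimrecPred.and (Primrec.eq.comp hj (Primrec.const 3))
      (Primrec.eq.comp hi (Primrec.const (N + 1))))
      (primrec_blockRotFun (Primrec.const 2) hd3 he hx) ?_
    exact Primrec.ite (PrimrecPred.and (Primrec.eq.comp hj (Primrec.const 4))
      (Primrec.eq.comp hi (Primrec.const (N + 2))))
      (primrec_blockRotFun (Primrec.const 3) hd3 he hx) hx

variable {N}

lemma rotGen_cond_snd (i : ℕ) (b : Bool) (k : Fin 3) (o q x : ℕ) :
    blockRot o q ((cond b (rotGen s i) (rotGen s i)⁻¹).2 k) x =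
      if i = N + k then blockRotFun o q (cond b 1 2) x else x := by
  by_cases h : i = N + k
  · rw [if_pos h, blockRot_apply, rotGen, dif_neg (by omega)]
    rcases b with _ | _
    · simp only [cond_false, Prod.snd_inv, Pi.inv_apply, if_pos h]; rfl
    · simp only [cond_true, if_pos h]; rfl
  · rw [if_neg h]
    have : (cond b (rotGen s i) (rotGen s i)⁻¹).2 k = 1 := by
      by_cases h' : i < N
      · rw [rotGen, dif_pos h']
        rcases b with _ | _ <;> simp
      · rw [rotGen, dif_neg h']
        rcases b with _ | _ <;> simp [h]
    rw [this, map_one, Perm.one_apply]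

lemma describes_rotTable (hf : ∀ g ≠ 1, ∀ N, ∃ n, N ≤ n ∧ f n g ≠ 1)
    {A : ℕ → ℕ × Bool → ℕ → ℕ} (hA : ∀ n (i : Fin N) b (x : Fin (d n)),
      A n (i, b) x = f n (cond b (s i) (s i)⁻¹) x) :
    (rotData d f hf).Describes (rotGen s) (rotTable N d A) := by
  rintro n ⟨j, i, b⟩ x
  simp only [rotTable]
  match j with
  | 0 => simp
  | 1 =>
    rw [if_pos rfl, if_neg one_ne_zero]
    change _ = doubled (d n) (f n (cond b (rotGen s i) (rotGen s i)⁻¹).1) x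
    rw [doubled_apply, doubledFun]
    by_cases hx : x / 2 < d n
    · rw [dif_pos hx]
      by_cases hi : i < N
      · have h1 := hA n ⟨i, hi⟩ b ⟨x / 2, hx⟩
        simp only at h1
        rw [if_pos ⟨hi, hx⟩, h1, rotGen, dif_pos hi]
        rcases b with _ | _ <;> rfl
      · rw [if_neg fun h => hi h.1, rotGen, dif_neg hi]
        rcases b with _ | _ <;> simp [Nat.div_add_mod]
    · rw [if_neg fun h => hx h.2, dif_neg hx]
  | 2 =>
    refine Eq.trans ?_ (rotGen_cond_snd s i b 0 0 1 x).symm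
    simp
  | 3 =>
    refine Eq.trans ?_ (rotGen_cond_snd s i b 1 2 (d n + 3) x).symm
    simp
  | 4 =>
    refine Eq.trans ?_ (rotGen_cond_snd s i b 2 3 (d n + 3) x).symm
    simp
  | j + 5 =>
    have h1 : (rotData d f hf).act n (j + 5) = 1 := (rotData d f hf).act_of_gt n _ (by omega)
    simp only [h1]
    simp

end

/-! ### Computable sequences of finite quotients -/

lemma homCode_eq_one_iff {G : Type*} [Group G] {N m m' : ℕ} {s : Fin N → G}
    (hs : Subgroup.closure (Set.range s) = ⊤) {f : G →* Perm (Fin m)} {f' : G →* Perm (Fin m')}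
    (h : homCode s f = homCode s f') (g : G) : f g = 1 ↔ f' g = 1 := by
  have hm : m = m' := congrArg Prod.fst h
  subst hm
  have h1 : List.ofFn _ = List.ofFn _ := congrArg Prod.snd h
  have h2 : f = f' := by
    refine MonoidHom.eq_of_eqOn_dense hs ?_
    rintro _ ⟨i, rfl⟩
    ext k
    exact congrFun (List.ofFn_injective (congrFun (List.ofFn_injective h1) i)) k
  rw [h2]

/-- The action of a generator or of its inverse, read off from the description of a finite
quotient. -/
def codeAction (c : ℕ × List (List ℕ)) (p : ℕ × Bool) (x : ℕ) : ℕ :=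
  cond p.2 ((c.2.getD p.1 []).getD x 0) ((c.2.getD p.1 []).idxOf x)

lemma codeAction_homCode {G : Type*} [Group G] {N m : ℕ} (s : Fin N → G) (f : G →* Perm (Fin m))
    (i : Fin N) (b : Bool) (x : Fin m) :
    codeAction (homCode s f) (i, b) x = f (cond b (s i) (s i)⁻¹) x := by
  have h1 : (homCode s f).2.getD i [] = List.ofFn fun k : Fin m => (f (s i) k : ℕ) := by
    simp [homCode]
  simp only [codeAction, h1]
  rcases b with _ | _
  · have h2 : (List.ofFn fun k : Fin m => (f (s i) k : ℕ)).Nodup :=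
      List.nodup_ofFn_ofInjective fun k k' h => (f (s i)).injective (Fin.ext h)
    set y := f (s i)⁻¹ x with hy
    have h3 : (List.ofFn fun k : Fin m => (f (s i) k : ℕ))[(y : ℕ)]'(by simp) = x := by
      rw [List.getElem_ofFn, hy, Fin.eta, ← Perm.mul_apply, ← map_mul, mul_inv_cancel, map_one,
        Perm.one_apply]
    simp only [cond_false]
    conv_lhs => rw [← h3]
    exact h2.idxOf_getElem y _
  · simp

section

open Encodable Nat.Partrec

/-- A group with the property `IsEFRFPlus` has a primitive recursive sequence of finite quotients in
which every quotient found by the algorithm occurs infinitely often: the `n`-th quotient is found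
by running the algorithm for a number of steps and on an input that are both coded by `n`. -/
lemma IsEFRFPlus.exists_actions {G : Type*} [Group G] (h : IsEFRFPlus G) :
    ∃ (N : ℕ) (s : Fin N → G) (d : ℕ → ℕ) (f : ∀ n, G →* Perm (Fin (d n)))
      (A : ℕ → ℕ × Bool → ℕ → ℕ), Subgroup.closure (Set.range s) = ⊤ ∧ Primrec d ∧
      (Primrec fun p : ℕ × (ℕ × Bool) × ℕ => A p.1 p.2.1 p.2.2) ∧
      (∀ g ≠ 1, ∀ N, ∃ n, N ≤ n ∧ f n g ≠ 1) ∧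
      ∀ n (i : Fin N) b (x : Fin (d n)), A n (i, b) x = f n (cond b (s i) (s i)⁻¹) x := by
  obtain ⟨N, s, hs, M, hM, hMs⟩ := h
  obtain ⟨c, hc⟩ := Partrec.exists_code hM
  set table : ℕ → ℕ × List (List ℕ) := fun n =>
    ((decode (α := SymWord N × ℕ) n.unpair.1).bind fun p =>
      (Code.evaln p.2 c (encode p.1)).bind fun e => decode (α := ℕ × List (List ℕ)) e).getD
      (homCode s (1 : G →* Perm (Fin 0))) with htable
  have hprim : Primrec table := by
    refine Primrec.option_getD.comp ?_ (Primrec.const _)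
    refine Primrec.option_bind (Primrec.decode.comp (Primrec.fst.comp Primrec.unpair)) ?_
    refine Primrec.option_bind (f := fun p : ℕ × SymWord N × ℕ =>
      Code.evaln p.2.2 c (encode p.2.1)) ?_ (Primrec.decode.comp Primrec.snd)
    exact Code.primrec_evaln.comp (((Primrec.snd.comp Primrec.snd).pair (Primrec.const c)).pair
      (Primrec.encode.comp (Primrec.fst.comp Primrec.snd)))
  have hex : ∀ n, ∃ (m : ℕ) (f : G →* Perm (Fin m)), homCode s f = table n := by
    intro n
    simp only [htable]
    cases hd : decode (α := SymWord N × ℕ) n.unpair.1 with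
    | none => exact ⟨0, 1, rfl⟩
    | some p =>
      cases he : Code.evaln p.2 c (encode p.1) with
      | none => exact ⟨0, 1, by simp [he]⟩
      | some e =>
        have h1 : e ∈ (M p.1).map encode := by
          rw [← hc]; exact Code.evaln_sound he
        obtain ⟨y, hy, rfl⟩ := (Part.mem_map_iff _).1 h1
        have hne : wordEval s p.1 ≠ 1 := fun h =>
          (hMs p.1).2 h (Part.dom_iff_mem.2 ⟨y, hy⟩)
        obtain ⟨m, f, -, hf⟩ := (hMs p.1).1 hne
        refine ⟨m, f, ?_⟩
        simp only [Part.mem_unique hf hy, Option.bind_some, he, encodek, Option.getD_some]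
  choose d f hdf using hex
  have hd : ∀ n, d n = (table n).1 := fun n => congrArg Prod.fst (hdf n)
  refine ⟨N, s, d, f, fun n => codeAction (table n), hs,
    (Primrec.fst.comp hprim).of_eq fun n => (hd n).symm, ?_, ?_, ?_⟩
  · have ht : Primrec fun p : ℕ × (ℕ × Bool) × ℕ => (table p.1).2.getD p.2.1.1 [] :=
      (Primrec.list_getD []).comp (Primrec.snd.comp (hprim.comp Primrec.fst))
        (Primrec.fst.comp (Primrec.fst.comp Primrec.snd))
    have hx : Primrec fun p : ℕ × (ℕ × Bool) × ℕ => p.2.2 := Primrec.snd.comp Primrec.snd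
    exact Primrec.cond (Primrec.snd.comp (Primrec.fst.comp Primrec.snd))
      ((Primrec.list_getD 0).comp ht hx) (Primrec.list_idxOf.comp hx ht)
  · intro g hg K
    obtain ⟨w, rfl⟩ := exists_wordEval hs g
    obtain ⟨m, f₀, hne, hmem⟩ := (hMs w).1 hg
    have h1 : encode (homCode s f₀) ∈ c.eval (encode w) := by
      rw [hc]; exact Part.mem_map _ hmem
    obtain ⟨k, hk⟩ := Code.evaln_complete.1 h1
    refine ⟨Nat.pair (encode (w, k)) K, Nat.right_le_pair _ _, fun h => hne ?_⟩
    refine (homCode_eq_one_iff hs ?_ _).1 h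
    rw [hdf]
    simp only [htable, Nat.unpair_pair, encodek, Option.bind_some]
    rw [show Code.evaln k c (encode w) = some (encode (homCode s f₀)) from hk]
    simp only [Option.bind_some, encodek, Option.getD_some]
  · intro n i b x
    simp only [← hdf n]
    exact codeAction_homCode s (f n) i b x

end

theorem theoremB (G : Type*) [Group G] (hfg : Group.FG G) (hrf : Group.ResiduallyFinite G) :
    (∃ (Γ : Type) (_ : Group Γ) (ι : G →* Γ),
      Group.FG Γ ∧ IsBranchGroup Γ ∧ IsFrattiniEmbedding ι) ∧
    (IsRecursivelyPresented G → IsEFRFPlus G →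
      ∃ (Γ : Type) (_ : Group Γ) (ι : G →* Γ),
        Group.FG Γ ∧ IsBranchGroup Γ ∧ IsFrattiniEmbedding ι ∧
          IsRecursivelyPresented Γ ∧ IsEFRFPlus Γ) := by
  constructor
  · obtain ⟨d, f, hf⟩ := exists_actions hfg hrf
    exact ⟨(rotData d f hf).grp 0, inferInstance,
      (rotData d f hf).directed.comp (MonoidHom.inl G RotGroup), fg_grp _ hfg,
      (rotData d f hf).isBranchGroup,
      (rotData d f hf).isFrattiniEmbedding_directed.comp isFrattiniEmbedding_inl⟩
  · intro hrp hef
    obtain ⟨N, s, d, f, A, hs, hd, hA, hf, hfA⟩ := hef.exists_actions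
    have hφ := describes_rotTable s d f hf hfA
    have hφp := primrec_rotTable N d hd hA
    have hm : Primrec (rotData d f hf).m :=
      Primrec.nat_add.comp (Primrec.nat_mul.comp (Primrec.const 3)
        (Primrec.nat_add.comp hd (Primrec.const 3))) (Primrec.const 3)
    have hgen : Subgroup.closure (Set.range ((rotData d f hf).codeGen (rotGen s)
        fun e : Fin (5 * (N + 3)) => ((e : ℕ) / (N + 3), (e : ℕ) % (N + 3)))) = ⊤ :=
      -- the generators `branchGen` are by definition those with these codes
      closure_branchGen (rotData d f hf) hs
    exact ⟨(rotData d f hf).grp 0, inferInstance,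
      (rotData d f hf).directed.comp (MonoidHom.inl G RotGroup), fg_grp _ hfg,
      (rotData d f hf).isBranchGroup,
      (rotData d f hf).isFrattiniEmbedding_directed.comp isFrattiniEmbedding_inl,
      isRecursivelyPresented_of_rePred hgen
        (hφ.rePred hφp hm (rePred_genVal_rotGen s (hrp.rePred s)) _),
      hφ.isEFRFPlus hφp hm _ hgen⟩
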